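/- Let $X$ be a compact metric space with infinitely many points and let $T:X\to X$ be a continuous map with Bowen's specification property: for every $\epsilon>0$ there is an integer $M(\epsilon)\ge 0$ such that for all $k\ge 2$, all points $x_1,\dots,x_k\in X$, all integers $0\le a_1\le b_1<a_2\le b_2<\dots<a_k\le b_k$ with $a_{i+1}-b_i\ge M(\epsilon)$ for $1\le i<k$, and every integer $p\ge M(\epsilon)+b_k-a_1$, there is $x\in X$ with $T^p(x)=x$ and $d(T^j x,T^j x_i)<\epsilon$ whenever $1\le i\le k$ and $a_i\le j\le b_i$. Notation. All measures are Borel. $M(T,X)$ is the set of $T$-invariant probability measures, $S_\mu$ is the support of $\mu$, and $M_x(T)$ is the set of weak$^*$ limits of subsequences of $\frac1n\sum_{i=0}^{n-1}\delta_{T^i x}$. For $\mu\in M(T,X)$, $G_\mu$ is the set of $x$ such that $\frac1n\sum_{i=0}^{n-1}\phi(T^i x)\to\int\phi\,d\mu$ for every continuous $\phi:X\to\mathbb R$. For $x\in X$, $C_x$ is the minimal center of attraction of $x$, i.e. the minimal closed set $E\subseteq X$ with $T(E)\subseteq E$ such that for every $\epsilon>0$ the orbit of $x$ visits the $\epsilon$-neighbourhood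 of $E$ with asymptotic frequency $1$. Put - $A(T)$: the points $x$ such that for every open $U\ni x$ there is $N>0$ such that every interval $[n,n+N]$, $n\ge1$, contains some $k$ with $T^k x\in U$; - $W(T)$ (resp. $QW(T)$): the points $x$ such that for every $\epsilon>0$, the $\liminf$ (resp. $\limsup$) as $n\to\infty$ of $\frac1n\#\{0\le i<n: d(T^i x,x)<\epsilon\}$ is positive; - $V(T)=\{x\in QW(T): S_\mu=C_x\text{ for some }\mu\in M_x(T)\}$; - $QR(T)=\bigcup_{\mu\in M(T,X)}G_\mu$, $\;I(T)=X\setminus QR(T)$, $\;R(T)=\bigcup_{\mu\ \mathrm{ergodic}}(G_\mu\cap S_\mu)$. For continuous $\phi:X\to\mathbb R$ and $a\in\mathbb R$, let $R_\phi(T)$ (resp. $R_{\phi,a}(T)$) be the set of $x$ for which $\frac1n\sum_{i=0}^{n-1}\phi(T^i x)$ converges (resp. converges to $a$), let $I_\phi(T)=X\setminus R_\phi(T)$, and let $L_\phi=[\inf_{\mu\in M(T,X)}\int\phi\,d\mu,\ \sup_{\mu\in M(T,X)}\int\phi\,d\mu]$. A list $\{Z_1,\dots,Z_k\}$ of subsets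 of $X$ has dense gaps with respect to $Y\subseteq X$ if $\overline{(Z_{i+1}\setminus Z_i)\cap Y}=\overline{Y}$ for all $1\le i<k$. Then: (A) $\{A(T),\,A(T)\cup R(T),\,QR(T),\,W(T),\,V(T),\,QW(T),\,I(T)\}$ has dense gaps with respect to $X$; (B) for every continuous $\phi:X\to\mathbb R$, $\{A(T),\,A(T)\cup R(T),\,QR(T),\,W(T),\,V(T),\,QW(T),\,I(T)\}$ has dense gaps with respect to $R_\phi(T)$; (C) for every continuous $\phi:X\to\mathbb R$ with $I_\phi(T)\ne\emptyset$, $\{QR(T),\,W(T),\,V(T),\,QW(T),\,I(T)\}$ has dense gaps with respect to $I_\phi(T)$; (D) for every continuous $\phi:X\to\mathbb R$ with $I_\phi(T)\ne\emptyset$ and every $a\in\mathrm{Int}(L_\phi)$, $\{A(T)\cup R(T),\,QR(T),\,W(T),\,V(T),\,QW(T),\,I(T)\}$ has dense gaps with respect to $R_{\phi,a}(T)$. -/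

import Mathlib

open MeasureTheory Filter Topology

namespace BowenSpec

noncomputable section

variable {X : Type*}

section Dynamics

variable [MetricSpace X]

/-- Bowen's specification property: finitely many orbit segments (at least two; here `k + 1` of them
with `1 ≤ k`), on time windows `[a i, b i]` separated by gaps of length at least `M`, are
`ε`-shadowed by a point of any prescribed period `p ≥ M + b_last - a_first`. -/
def BowenSpecification (T : X → X) : Prop :=
  ∀ ε : ℝ, 0 < ε → ∃ M : ℕ, ∀ k : ℕ, 1 ≤ k →
    ∀ (x : Fin (k + 1) → X) (a b : Fin (k + 1) → ℕ),
      (∀ i, a i ≤ b i) →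
      (∀ i : Fin k, b i.castSucc < a i.succ ∧ b i.castSucc + M ≤ a i.succ) →
      ∀ p : ℕ, M + b (Fin.last k) ≤ p + a 0 →
        ∃ z : X, T^[p] z = z ∧
          ∀ i, ∀ j : ℕ, a i ≤ j → j ≤ b i → dist (T^[j] z) (T^[j] (x i)) < ε

/-- The proportion of times `0 ≤ i < n` at which the orbit of `x` is in `E`. -/
def visitFreq (T : X → X) (x : X) (E : Set X) (n : ℕ) : ℝ :=
  birkhoffAverage ℝ T (E.indicator fun _ => (1 : ℝ)) n x

/-- Almost periodic points. -/
def almostPeriodic (T : X → X) : Set X :=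
  {x | ∀ U : Set X, IsOpen U → x ∈ U →
    ∃ N : ℕ, 0 < N ∧ ∀ n : ℕ, 1 ≤ n → ∃ k ∈ Set.Icc n (n + N), T^[k] x ∈ U}

/-- Weakly almost periodic points. -/
def weaklyAlmostPeriodic (T : X → X) : Set X :=
  {x | ∀ ε : ℝ, 0 < ε → 0 < liminf (visitFreq T x (Metric.ball x ε)) atTop}

/-- Quasi-weakly almost periodic points. -/
def quasiWeaklyAlmostPeriodic (T : X → X) : Set X :=
  {x | ∀ ε : ℝ, 0 < ε → 0 < limsup (visitFreq T x (Metric.ball x ε)) atTop}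

/-- `E` is a center of attraction of `T` relative to `X₀`. -/
def IsCenterOfAttraction (T : X → X) (X₀ E : Set X) : Prop :=
  IsClosed E ∧ Set.MapsTo T E E ∧
    ∀ x ∈ X₀, ∀ ε : ℝ, 0 < ε → Tendsto (visitFreq T x (Metric.thickening ε E)) atTop (𝓝 1)

/-- `C` is a minimal center of attraction of `T` relative to `X₀`: a center of attraction, no
proper subset of which is one. -/
def IsMinimalCenter (T : X → X) (X₀ C : Set X) : Prop :=
  Minimal (IsCenterOfAttraction T X₀) C

/-- The points whose Birkhoff averages for `φ` converge. -/
def phiRegular (T : X → X) (φ : C(X, ℝ)) : Set X :=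
  {x | ∃ a : ℝ, Tendsto (fun n => birkhoffAverage ℝ T φ n x) atTop (𝓝 a)}

/-- The points whose Birkhoff averages for `φ` diverge. -/
def phiIrregular (T : X → X) (φ : C(X, ℝ)) : Set X :=
  (phiRegular T φ)ᶜ

/-- The points whose Birkhoff averages for `φ` converge to `a`. -/
def phiLevel (T : X → X) (φ : C(X, ℝ)) (a : ℝ) : Set X :=
  {x | Tendsto (fun n => birkhoffAverage ℝ T φ n x) atTop (𝓝 a)}

end Dynamics

section Measures

variable [MetricSpace X] [MeasurableSpace X]

/-- The invariant probability measures of `T`. -/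
def invariantMeasures (T : X → X) : Set (ProbabilityMeasure X) :=
  {μ | MeasurePreserving T (μ : Measure X) (μ : Measure X)}

/-- The ergodic invariant probability measures of `T`. -/
def ergodicMeasures (T : X → X) : Set (ProbabilityMeasure X) :=
  {μ | Ergodic T (μ : Measure X)}

/-- The empirical measure of the orbit segment `x, T x, …, T ^ n x` (of length `n + 1`). -/
def empirical (T : X → X) (x : X) (n : ℕ) : ProbabilityMeasure X :=
  ⟨((n : ENNReal) + 1)⁻¹ • ∑ i ∈ Finset.range (n + 1), Measure.dirac (T^[i] x), ⟨by
    simp only [Measure.smul_apply, Measure.finsetSum_apply, measure_univ, Finset.sum_const,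
      Finset.card_range, smul_eq_mul, nsmul_eq_mul, mul_one]
    push_cast
    exact ENNReal.inv_mul_cancel (by simp) (by simp)⟩⟩

variable [BorelSpace X]

/-- The set `M_x(T)` of weak-* limits of subsequences of the empirical measures of `x`. -/
def limitMeasures (T : X → X) (x : X) : Set (ProbabilityMeasure X) :=
  {μ | ∃ s : ℕ → ℕ, StrictMono s ∧ Tendsto (fun n => empirical T x (s n)) atTop (𝓝 μ)}

/-- The points `x ∈ QW(T)` for which some `μ ∈ M_x(T)` has support equal to the minimal center of
attraction of `x`. -/
def V (T : X → X) : Set X :=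
  {x | x ∈ quasiWeaklyAlmostPeriodic T ∧ ∃ C : Set X, IsMinimalCenter T {x} C ∧
    ∃ μ ∈ limitMeasures T x, (μ : Measure X).support = C}

/-- The generic points of `μ`. -/
def generic (T : X → X) (μ : ProbabilityMeasure X) : Set X :=
  {x | ∀ φ : C(X, ℝ),
    Tendsto (fun n => birkhoffAverage ℝ T φ n x) atTop (𝓝 (∫ y, φ y ∂(μ : Measure X)))}

/-- Quasiregular points. -/
def quasiregular (T : X → X) : Set X :=
  ⋃ μ ∈ invariantMeasures T, generic T μ

/-- Irregular points. -/
def irregular (T : X → X) : Set X :=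
  (quasiregular T)ᶜ

/-- Regular points. -/
def regular (T : X → X) : Set X :=
  ⋃ μ ∈ ergodicMeasures T, generic T μ ∩ (μ : Measure X).support

/-- The values `∫ φ dμ` over the invariant probability measures `μ`. -/
def phiIntegrals (T : X → X) (φ : C(X, ℝ)) : Set ℝ :=
  (fun μ : ProbabilityMeasure X => ∫ y, φ y ∂(μ : Measure X)) '' invariantMeasures T

/-- The interval `L_φ`. -/
def spectrumInterval (T : X → X) (φ : C(X, ℝ)) : Set ℝ :=
  Set.Icc (sInf (phiIntegrals T φ)) (sSup (phiIntegrals T φ))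

end Measures

/-- `Z₁, …, Z_k` has dense gaps with respect to `Y`: for consecutive members,
`(Z_{i+1} \ Z_i) ∩ Y` has the same closure as `Y`. -/
def HasDenseGaps [TopologicalSpace X] (Z : List (Set X)) (Y : Set X) : Prop :=
  Z.IsChain fun A B => closure ((B \ A) ∩ Y) = closure Y

end

end BowenSpec

/-! All sets `Y` involved turn out to be dense, so each gap reduces to producing, in every nonempty
open `U`, a point of `Y` with prescribed statistical behaviour (`closure_inter_eq_of_dense`).

Such points come from one gluing construction. Specification makes the weak-* closure of the
periodic orbit measures convex (`mix_mem_periodicClosure`). Concatenating ever longer pieces of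
periodic orbits then gives, for any sequence `κ` in this closure, a point of `U` whose empirical
measures return near every `κ m` infinitely often and are otherwise asymptotic to mixtures of two of
the `κ m` (`exists_isGlued`). Thus the averages of `f` converge if all `κ m` integrate `f` to the
same value, and diverge if two of them disagree.

The gaps are distinguished by the choice of `κ`. Let `η` have full support and let `ν`, `ν₀`, `ν₁`
be finitely supported. A constant ergodic `κ` of full support gives a regular point. A constant `ν`
gives a quasiregular point which is not regular when chosen off the finite carrier. The pair `η`,
`(η + ν) / 2` gives an irregular point in `W(T)`; the pair `η`, `ν` a point of `V(T)` outside
`W(T)`; the pair `ν₀`, `ν₁` an irregular point outside `QW(T)`. Finitely supported measures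
converging to `ν₀` and jointly charging every ball give a point of `QW(T)` outside `V(T)`, as all
its limit measures are finitely supported while its minimal center is `X`.

The measures are drawn from an `IsRich` family: the whole periodic closure, or its slice where `∫ φ
= a` (`isRich_level`). The slice forces the averages of `φ` to converge to `a`. Full support is
generic in a rich family by Baire (`IsRich.exists_full_support`); in the periodic closure so is
ergodicity, tested by variances of Birkhoff averages. -/

namespace BowenSpec

set_option linter.unusedSectionVars false

/-! ### Tent functions as continuous substitutes for balls -/

section Bump

variable {X : Type*} [MetricSpace X]

/-- A tent function at `y`, positive exactly on the ball of radius `r`. -/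
noncomputable def bump (y : X) (r : ℝ) : C(X, ℝ) :=
  ⟨fun z => max 0 (r - dist z y), by fun_prop⟩

theorem bump_nonneg (y : X) (r : ℝ) (z : X) : 0 ≤ bump y r z := le_max_left _ _

theorem bump_eq_zero {y : X} {r : ℝ} {z : X} (h : r ≤ dist z y) : bump y r z = 0 :=
  max_eq_left (by linarith)

theorem bump_le {y : X} {r : ℝ} (hr : 0 ≤ r) (z : X) : bump y r z ≤ r :=
  max_le hr (by linarith [dist_nonneg (x := z) (y := y)])

theorem bump_pos {y : X} {r : ℝ} {z : X} (h : dist z y < r) : 0 < bump y r z :=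
  lt_max_of_lt_right (by linarith)

theorem bump_mono {y y' : X} {r r' : ℝ} (h : dist y y' + r ≤ r') (z : X) :
    bump y r z ≤ bump y' r' z :=
  max_le_max le_rfl (by linarith [dist_triangle z y y'])

-- Reduces positivity on all balls to countably many conditions, as Baire arguments require: centres
-- run through a dense sequence, radii through `1 / (n + 1)`.
variable (X) in
theorem exists_countable_bumps [CompactSpace X] [Nonempty X] :
    ∃ (c : ℕ → X) (s : ℕ → ℝ), (∀ i, 0 < s i) ∧
      ∀ (y : X) (r : ℝ), 0 < r → ∃ i, ∀ z, bump (c i) (s i) z ≤ bump y r z := by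
  refine ⟨fun i => TopologicalSpace.denseSeq X i.unpair.1, fun i => 1 / ((i.unpair.2 : ℝ) + 1),
    fun i => by positivity, fun y r hr => ?_⟩
  obtain ⟨n, hn⟩ := exists_nat_one_div_lt (half_pos hr)
  obtain ⟨k, hk⟩ := (TopologicalSpace.denseRange_denseSeq X).exists_dist_lt y
    (half_pos hr)
  refine ⟨Nat.pair k n, bump_mono ?_⟩
  simp only [Nat.unpair_pair]
  rw [dist_comm] at hk
  linarith

end Bump

/-! ### Weak-* topology, convex combinations and supports -/

section WeakStar

variable {X : Type*} [MetricSpace X] [CompactSpace X] [MeasurableSpace X] [BorelSpace X]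

/-- The integral of a continuous function against a probability measure. -/
noncomputable def integ (μ : ProbabilityMeasure X) (f : C(X, ℝ)) : ℝ := ∫ y, f y ∂(μ : Measure X)

theorem integrable_continuousMap (μ : Measure X) [IsFiniteMeasure μ] (f : C(X, ℝ)) :
    Integrable (fun y => f y) μ :=
  (BoundedContinuousFunction.mkOfCompact f).integrable μ

theorem tendsto_iff_integ {ι : Type*} {l : Filter ι} {u : ι → ProbabilityMeasure X}
    {μ : ProbabilityMeasure X} :
    Tendsto u l (𝓝 μ) ↔ ∀ f : C(X, ℝ), Tendsto (fun i => integ (u i) f) l (𝓝 (integ μ f)) := by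
  rw [ProbabilityMeasure.tendsto_iff_forall_integral_tendsto]
  exact ⟨fun h f => h (BoundedContinuousFunction.mkOfCompact f), fun h f => h f.toContinuousMap⟩

theorem continuous_integ (f : C(X, ℝ)) :
    Continuous fun μ : ProbabilityMeasure X => integ μ f :=
  continuous_iff_continuousAt.2 fun _ => tendsto_iff_integ.1 tendsto_id f

theorem ext_of_integ {μ ν : ProbabilityMeasure X} (h : ∀ f, integ μ f = integ ν f) : μ = ν := by
  have : (μ : Measure X) = (ν : Measure X) :=
    ext_of_forall_integral_eq_of_IsFiniteMeasure fun f => h f.toContinuousMap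
  exact Subtype.ext this

theorem integ_mono (μ : ProbabilityMeasure X) {f g : C(X, ℝ)} (h : ∀ y, f y ≤ g y) :
    integ μ f ≤ integ μ g := by
  unfold integ
  exact integral_mono (integrable_continuousMap _ f) (integrable_continuousMap _ g) h

theorem integ_nonneg (μ : ProbabilityMeasure X) {f : C(X, ℝ)} (h : ∀ y, 0 ≤ f y) :
    0 ≤ integ μ f :=
  integral_nonneg h

theorem integ_const (μ : ProbabilityMeasure X) (c : ℝ) :
    integ μ (ContinuousMap.const X c) = c := by
  simp [integ]

theorem integ_sub (μ : ProbabilityMeasure X) (f g : C(X, ℝ)) :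
    integ μ (f - g) = integ μ f - integ μ g := by
  simpa [integ] using
    integral_sub (integrable_continuousMap (μ : Measure X) f) (integrable_continuousMap _ g)

theorem integ_add (μ : ProbabilityMeasure X) (f g : C(X, ℝ)) :
    integ μ (f + g) = integ μ f + integ μ g := by
  simpa [integ] using
    integral_add (integrable_continuousMap (μ : Measure X) f) (integrable_continuousMap _ g)

theorem abs_integ_le (μ : ProbabilityMeasure X) (f : C(X, ℝ)) : |integ μ f| ≤ ‖f‖ := by
  have := norm_integral_le_of_norm_le_const (μ := (μ : Measure X)) (C := ‖f‖)
    (ae_of_all _ fun y => f.norm_coe_le_norm y)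
  simpa [integ] using this

/-- The convex combination `(1 - t) μ + t ν`. -/
noncomputable def mix (t : unitInterval) (μ ν : ProbabilityMeasure X) : ProbabilityMeasure X :=
  ⟨ENNReal.ofReal (1 - t) • (μ : Measure X) + ENNReal.ofReal t • (ν : Measure X), ⟨by
    have h : (0 : ℝ) ≤ 1 - t := sub_nonneg.2 t.2.2
    simp [← ENNReal.ofReal_add h t.2.1]⟩⟩

theorem coe_mix (t : unitInterval) (μ ν : ProbabilityMeasure X) :
    (mix t μ ν : Measure X) =
      ENNReal.ofReal (1 - t) • (μ : Measure X) + ENNReal.ofReal t • (ν : Measure X) := rfl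

theorem integ_mix (t : unitInterval) (μ ν : ProbabilityMeasure X) (f : C(X, ℝ)) :
    integ (mix t μ ν) f = (1 - t) * integ μ f + t * integ ν f := by
  have h : (0 : ℝ) ≤ 1 - t := sub_nonneg.2 t.2.2
  unfold integ
  rw [coe_mix, integral_add_measure, integral_smul_measure, integral_smul_measure,
    ENNReal.toReal_ofReal h, ENNReal.toReal_ofReal t.2.1, smul_eq_mul, smul_eq_mul]
  · exact (integrable_continuousMap _ f).smul_measure ENNReal.ofReal_ne_top
  · exact (integrable_continuousMap _ f).smul_measure ENNReal.ofReal_ne_top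

theorem continuous_mix :
    Continuous fun p : unitInterval × ProbabilityMeasure X × ProbabilityMeasure X =>
      mix p.1 p.2.1 p.2.2 := by
  refine continuous_iff_continuousAt.2 fun p => tendsto_iff_integ.2 fun f => ?_
  simp only [integ_mix]
  have h1 := (continuous_integ (X := X) f).comp (continuous_fst.comp
    (continuous_snd (X := unitInterval) (Y := ProbabilityMeasure X × ProbabilityMeasure X)))
  have h2 := (continuous_integ (X := X) f).comp (continuous_snd.comp
    (continuous_snd (X := unitInterval) (Y := ProbabilityMeasure X × ProbabilityMeasure X)))
  have h0 : Continuous fun p : unitInterval × ProbabilityMeasure X × ProbabilityMeasure X =>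
    (p.1 : ℝ) := continuous_subtype_val.comp continuous_fst
  exact (((continuous_const.sub h0).mul h1).add (h0.mul h2)).tendsto p

theorem mix_null {t : unitInterval} {μ ν : ProbabilityMeasure X} {s : Set X}
    (hμ : (μ : Measure X) s = 0) (hν : (ν : Measure X) s = 0) : (mix t μ ν : Measure X) s = 0 := by
  rw [coe_mix, Measure.add_apply, Measure.smul_apply, Measure.smul_apply, hμ, hν]
  simp

theorem measure_ball_pos_of_integ_bump_pos {μ : ProbabilityMeasure X} {y : X} {r : ℝ}
    (h : 0 < integ μ (bump y r)) : 0 < (μ : Measure X) (Metric.ball y r) := by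
  by_contra h0
  have h0 : (μ : Measure X) (Metric.ball y r) = 0 := by simpa using h0
  have : integ μ (bump y r) = 0 := by
    refine integral_eq_zero_of_ae ?_
    filter_upwards [measure_eq_zero_iff_ae_notMem.1 h0] with z hz
    exact bump_eq_zero (by simpa using hz)
  linarith

theorem integ_bump_pos {μ : ProbabilityMeasure X} {y : X} {r : ℝ}
    (h : 0 < (μ : Measure X) (Metric.ball y r)) : 0 < integ μ (bump y r) := by
  refine (integral_pos_iff_support_of_nonneg (bump_nonneg y r) (integrable_continuousMap _ _)).2
    (h.trans_le (measure_mono fun z hz => ?_))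
  exact (bump_pos hz).ne'

theorem support_eq_univ_of_integ_bump_pos {μ : ProbabilityMeasure X}
    (h : ∀ y r, 0 < r → 0 < integ μ (bump y r)) : (μ : Measure X).support = Set.univ := by
  refine Set.eq_univ_of_forall fun y => ?_
  rw [Measure.mem_support_iff_forall]
  intro U hU
  obtain ⟨r, hr, hrU⟩ := Metric.mem_nhds_iff.1 hU
  exact (measure_ball_pos_of_integ_bump_pos (h y r hr)).trans_le (measure_mono hrU)

theorem integ_eq_zero_of_eqOn {μ : ProbabilityMeasure X} {F : Set X}
    (hF : (μ : Measure X) Fᶜ = 0) {f : C(X, ℝ)} (hf : ∀ z ∈ F, f z = 0) : integ μ f = 0 := by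
  refine integral_eq_zero_of_ae ?_
  filter_upwards [measure_eq_zero_iff_ae_notMem.1 hF] with z hz
  exact hf z (by simpa using hz)

theorem integ_empirical (T : X → X) (x : X) (n : ℕ) (f : C(X, ℝ)) :
    integ (empirical T x n) f = birkhoffAverage ℝ T f (n + 1) x := by
  unfold integ empirical birkhoffAverage birkhoffSum
  simp only [ProbabilityMeasure.coe_mk]
  rw [integral_smul_measure, integral_finsetSum_measure fun i _ => integrable_continuousMap _ f]
  simp only [integral_dirac, smul_eq_mul]
  congr 1
  rw [ENNReal.toReal_inv]
  norm_cast

end WeakStar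

/-! ### Estimates for Birkhoff sums -/

section Sums

variable {X : Type*} [MetricSpace X] [CompactSpace X] {T : X → X}

theorem abs_birkhoffSum_le (f : C(X, ℝ)) (n : ℕ) (x : X) :
    |birkhoffSum T f n x| ≤ n * ‖f‖ := by
  refine (Finset.abs_sum_le_sum_abs _ _).trans ?_
  refine (Finset.sum_le_card_nsmul _ _ ‖f‖ fun i _ => f.norm_coe_le_norm _).trans ?_
  simp

theorem birkhoffAverage_eq_div (f : X → ℝ) (n : ℕ) (x : X) :
    birkhoffAverage ℝ T f n x = birkhoffSum T f n x / n := by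
  rw [birkhoffAverage, smul_eq_mul, inv_mul_eq_div]

theorem abs_birkhoffAverage_le (f : C(X, ℝ)) (n : ℕ) (x : X) :
    |birkhoffAverage ℝ T f n x| ≤ ‖f‖ := by
  rcases Nat.eq_zero_or_pos n with rfl | hn
  · simp
  · have hn' : (0 : ℝ) < n := by exact_mod_cast hn
    rw [birkhoffAverage_eq_div, abs_div, abs_of_pos hn', div_le_iff₀ hn', mul_comm]
    exact abs_birkhoffSum_le f n x

theorem abs_birkhoffSum_sub_le {f : C(X, ℝ)} {ε ω : ℝ}
    (hω : ∀ a b : X, dist a b < ε → |f a - f b| ≤ ω) {n : ℕ} {u v : X}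
    (h : ∀ i < n, dist (T^[i] u) (T^[i] v) < ε) :
    |birkhoffSum T f n u - birkhoffSum T f n v| ≤ n * ω := by
  unfold birkhoffSum
  rw [← Finset.sum_sub_distrib]
  refine (Finset.abs_sum_le_sum_abs _ _).trans ?_
  refine (Finset.sum_le_card_nsmul _ _ ω fun i hi => hω _ _ (h i (Finset.mem_range.1 hi))).trans ?_
  simp

/-- Full periods contribute exactly their mean, so only the last incomplete period costs anything,
uniformly in `t`. -/
theorem abs_birkhoffSum_periodic_sub_le (f : C(X, ℝ)) {q : X} {P : ℕ} (hP : 0 < P)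
    (hq : T^[P] q = q) (t : ℕ) :
    |birkhoffSum T f t q - t * birkhoffAverage ℝ T f P q| ≤ 2 * ‖f‖ * P := by
  have hP' : (0 : ℝ) < P := by exact_mod_cast hP
  induction t using Nat.strong_induction_on with
  | _ t ih =>
    rcases lt_or_ge t P with h | h
    · have h1 := abs_birkhoffSum_le (T := T) f t q
      have h2 := abs_birkhoffAverage_le (T := T) f P q
      have h3 : (t : ℝ) ≤ P := by exact_mod_cast h.le
      have h0 : (0 : ℝ) ≤ t := Nat.cast_nonneg t
      have h4 : |(t : ℝ) * birkhoffAverage ℝ T f P q| ≤ t * ‖f‖ := by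
        rw [abs_mul, abs_of_nonneg h0]
        exact mul_le_mul_of_nonneg_left h2 h0
      have h5 : (t : ℝ) * ‖f‖ ≤ P * ‖f‖ := mul_le_mul_of_nonneg_right h3 (norm_nonneg f)
      calc _ ≤ |birkhoffSum T f t q| + |(t : ℝ) * birkhoffAverage ℝ T f P q| := abs_sub _ _
        _ ≤ _ := by linarith
    · obtain ⟨s, rfl⟩ := Nat.exists_eq_add_of_le h
      have := ih s (by omega)
      rw [birkhoffSum_add, hq]
      have hs : birkhoffSum T f P q = P * birkhoffAverage ℝ T f P q := by
        rw [birkhoffAverage_eq_div]; field_simp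
      rw [hs]
      push_cast
      convert this using 2
      ring

theorem exists_modulus (f : C(X, ℝ)) {ω : ℝ} (hω : 0 < ω) :
    ∃ ε > 0, ∀ a b : X, dist a b < ε → |f a - f b| ≤ ω := by
  obtain ⟨ε, hε, h⟩ := Metric.uniformContinuous_iff.1
    (CompactSpace.uniformContinuous_of_continuous f.continuous) ω hω
  exact ⟨ε, hε, fun a b hab => (h hab).le⟩

end Sums

/-! ### First consequences of specification -/

section Specification

variable {X : Type*} [MetricSpace X] [CompactSpace X] {T : X → X}

theorem BowenSpecification.two_blocks_of_preimage (hspec : BowenSpecification T) {ε : ℝ}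
    (hε : 0 < ε) : ∃ M : ℕ, 1 ≤ M ∧ ∀ (u v : X) (n m : ℕ), ∃ z, T^[n + M + m + M] z = z ∧
      (∀ j ≤ n, dist (T^[j] z) (T^[j] u) < ε) ∧
      ∀ j ≤ m, dist (T^[n + M + j] z) (T^[n + M + j] v) < ε := by
  obtain ⟨M, hM⟩ := hspec ε hε
  -- The extra unit keeps the two windows disjoint and the period positive even when `M = 0`.
  refine ⟨M + 1, by omega, fun u v n m => ?_⟩
  obtain ⟨z, hz, hs⟩ := hM 1 le_rfl ![u, v] ![0, n + (M + 1)] ![n, n + (M + 1) + m]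
    (by intro i; fin_cases i <;> simp) (by intro i; fin_cases i; simp)
    (n + (M + 1) + m + (M + 1)) (by simp [Fin.last]; omega)
  refine ⟨z, hz, fun j hj => ?_, fun j hj => ?_⟩
  · exact hs 0 j (by simp) (by simpa using hj)
  · exact hs 1 (n + (M + 1) + j) (by simp) (by simp; omega)

theorem BowenSpecification.dense_periodic (hspec : BowenSpecification T) (x : X) {r : ℝ}
    (hr : 0 < r) : ∃ q n, T^[n + 1] q = q ∧ dist q x < r := by
  obtain ⟨M, hM, h⟩ := hspec.two_blocks_of_preimage hr
  obtain ⟨z, hz, h1, -⟩ := h x x 0 0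
  refine ⟨z, 0 + M + 0 + M - 1, ?_, by simpa using h1 0 le_rfl⟩
  rwa [Nat.sub_add_cancel (by omega)]

/-- The image is compact and contains the periodic points, which are dense. -/
theorem BowenSpecification.surjective (hspec : BowenSpecification T) (hT : Continuous T) :
    Function.Surjective T := by
  have hc : IsClosed (Set.range T) := (isCompact_range hT).isClosed
  intro x
  have : x ∈ closure (Set.range T) := by
    refine Metric.mem_closure_iff.2 fun r hr => ?_
    obtain ⟨q, n, hq, hd⟩ := hspec.dense_periodic x hr
    rw [Function.iterate_succ_apply'] at hq
    exact ⟨q, ⟨_, hq⟩, by rwa [dist_comm]⟩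
  rwa [hc.closure_eq] at this

/-- Specification shadows `v` at absolute times. Replacing `v` by a preimage under `T^[n + M]` lets
the second block follow the orbit of `v` from its own time zero. -/
theorem BowenSpecification.two_blocks (hspec : BowenSpecification T) (hT : Continuous T) {ε : ℝ}
    (hε : 0 < ε) : ∃ M : ℕ, 1 ≤ M ∧ ∀ (u v : X) (n m : ℕ), ∃ z, T^[n + M + m + M] z = z ∧
      (∀ j ≤ n, dist (T^[j] z) (T^[j] u) < ε) ∧
      ∀ j ≤ m, dist (T^[n + M + j] z) (T^[j] v) < ε := by
  obtain ⟨M, hM, h⟩ := hspec.two_blocks_of_preimage hε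
  refine ⟨M, hM, fun u v n m => ?_⟩
  obtain ⟨w, hw⟩ := (hspec.surjective hT).iterate (n + M) v
  obtain ⟨z, hz, h1, h2⟩ := h u w n m
  refine ⟨z, hz, h1, fun j hj => ?_⟩
  have := h2 j hj
  rwa [add_comm (n + M) j, Function.iterate_add_apply T j (n + M) w, hw,
    add_comm j (n + M)] at this

theorem finite_orbit_of_periodic {q : X} {n : ℕ} (hq : T^[n + 1] q = q) :
    (Set.range fun i => T^[i] q).Finite := by
  refine ((Set.finite_Iio (n + 1)).image fun i => T^[i] q).subset ?_
  rintro _ ⟨i, rfl⟩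
  refine ⟨i % (n + 1), Nat.mod_lt _ (Nat.succ_pos n), ?_⟩
  have hp : Function.IsPeriodicPt T (n + 1) q := hq
  exact hp.iterate_mod_apply i

/-- There are no isolated points: one would be periodic, and any orbit shadowing it at time zero
would be its own. By specification its finite orbit would then be dense, contradicting infinitude of
`X`. This allows witnesses to be chosen off any finite set. -/
theorem BowenSpecification.diff_finite_nonempty [Infinite X] (hspec : BowenSpecification T)
    (hT : Continuous T) {U F : Set X} (hU : IsOpen U) (hne : U.Nonempty) (hF : F.Finite) :
    (U \ F).Nonempty := by
  by_contra hcon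
  have hUF : U.Finite := hF.subset (Set.sdiff_eq_empty.1 (Set.not_nonempty_iff_eq_empty.1 hcon))
  obtain ⟨u, hu⟩ := hne
  have ho : IsOpen ({u} : Set X) := by
    have : ({u} : Set X) = U \ (U \ {u}) := by
      ext z; simp only [Set.mem_singleton_iff, Set.mem_sdiff]
      constructor
      · rintro rfl; exact ⟨hu, by simp⟩
      · rintro ⟨h1, h2⟩; by_contra h3; exact h2 ⟨h1, h3⟩
    rw [this]
    exact hU.sdiff (hUF.subset Set.sdiff_subset).isClosed
  obtain ⟨r, hr, hru⟩ := Metric.isOpen_iff.1 ho u rfl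
  obtain ⟨q, n, hq, hd⟩ := hspec.dense_periodic u hr
  obtain rfl : q = u := hru hd
  have hfin := finite_orbit_of_periodic hq
  refine Set.infinite_univ (hfin.subset fun v _ => ?_)
  rw [← hfin.isClosed.closure_eq]
  refine Metric.mem_closure_iff.2 fun ε hε => ?_
  obtain ⟨M, -, h⟩ := hspec.two_blocks hT (lt_min hr hε)
  obtain ⟨z, -, h1, h2⟩ := h q v 0 0
  obtain rfl : z = q := hru ((h1 0 le_rfl).trans_le (min_le_left _ _))
  refine ⟨_, ⟨0 + M + 0, rfl⟩, ?_⟩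
  rw [dist_comm]
  exact (h2 0 le_rfl).trans_le (min_le_right _ _)

end Specification

theorem tendsto_of_forall_eventually_abs_sub_le {ι : Type*} {l : Filter ι} {a b e : ι → ℝ}
    (he : Tendsto e l (𝓝 0)) (h : ∀ ω : ℝ, 0 < ω → ∀ᶠ k in l, |a k - b k| ≤ ω + e k) :
    Tendsto (fun k => a k - b k) l (𝓝 0) := by
  rw [Metric.tendsto_nhds]
  intro δ hδ
  filter_upwards [h (δ / 2) (half_pos hδ), he.eventually (gt_mem_nhds (half_pos hδ))] with k h1 h2
  rw [Real.dist_eq, sub_zero]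
  linarith

/-! ### Periodic orbit measures and convexity of their closure -/

section Periodic

variable {X : Type*} [MetricSpace X] [CompactSpace X] [MeasurableSpace X] [BorelSpace X]
  {T : X → X}

/-- The measures equidistributed on periodic orbits. -/
def periodicMeasures (T : X → X) : Set (ProbabilityMeasure X) :=
  {μ | ∃ q n, T^[n + 1] q = q ∧ μ = empirical T q n}

/-- The weak-* closure of the measures equidistributed on periodic orbits. -/
def periodicClosure (T : X → X) : Set (ProbabilityMeasure X) :=
  closure (periodicMeasures T)

theorem abs_birkhoffSum_two_blocks_sub_le {f : C(X, ℝ)} {ε ω : ℝ}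
    (hω : ∀ a b : X, dist a b < ε → |f a - f b| ≤ ω) {z u v : X} {n m M : ℕ}
    (h1 : ∀ j ≤ n, dist (T^[j] z) (T^[j] u) < ε)
    (h2 : ∀ j ≤ m, dist (T^[n + M + j] z) (T^[j] v) < ε) :
    |birkhoffSum T f (n + M + m + M) z - birkhoffSum T f n u - birkhoffSum T f m v| ≤
      (n + m) * ω + 2 * M * ‖f‖ := by
  rw [birkhoffSum_add, birkhoffSum_add, birkhoffSum_add]
  have e1 := abs_birkhoffSum_sub_le (T := T) hω (n := n) (u := z) (v := u)
    fun i hi => h1 i hi.le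
  have e2 := abs_birkhoffSum_sub_le (T := T) hω (n := m) (u := T^[n + M] z) (v := v)
    fun i hi => by
      rw [← Function.iterate_add_apply, add_comm i]
      exact h2 i hi.le
  have e3 := abs_birkhoffSum_le (T := T) f M (T^[n] z)
  have e4 := abs_birkhoffSum_le (T := T) f M (T^[n + M + m] z)
  rw [abs_le] at *
  constructor <;> linarith [e1.1, e1.2, e2.1, e2.2, e3.1, e3.2, e4.1, e4.2]

-- Shadow the first orbit for a share `1 - t` of the time and the second for a share `t`, and close
-- up. As the precision improves and the blocks lengthen, the resulting periodic measures converge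
-- to the mixture.
set_option maxHeartbeats 600000 in
theorem mix_periodic_mem_closure (hspec : BowenSpecification T) (hT : Continuous T)
    {μ ν : ProbabilityMeasure X} (hμ : μ ∈ periodicMeasures T) (hν : ν ∈ periodicMeasures T)
    (t : unitInterval) : mix t μ ν ∈ periodicClosure T := by
  obtain ⟨p, a, hp, rfl⟩ := hμ
  obtain ⟨q, b, hq, rfl⟩ := hν
  choose M hM hz using fun k : ℕ => hspec.two_blocks hT (Nat.one_div_pos_of_nat (α := ℝ) (n := k))
  -- The blocks have total length about `L k`, so the two gaps of length `M k` take a share at most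
  -- `2 / (k + 1)` of the period.
  set L : ℕ → ℝ := fun k => (k + 1) * M k with hL
  set n : ℕ → ℕ := fun k => ⌊(1 - (t : ℝ)) * L k⌋₊ with hn
  set m : ℕ → ℕ := fun k => ⌊(t : ℝ) * L k⌋₊ with hm
  choose z hper hz1 hz2 using fun k => hz k p q (n k) (m k)
  have ht0 := t.2.1
  have ht1 := t.2.2
  refine mem_closure_of_tendsto
    (f := fun k => empirical T (z k) (n k + M k + m k + M k - 1)) (b := atTop) ?_
    (Eventually.of_forall fun k => ⟨z k, _, ?_, rfl⟩)
  swap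
  · rw [Nat.sub_add_cancel (by have := hM k; omega)]
    exact hper k
  refine tendsto_iff_integ.2 fun f => ?_
  refine tendsto_sub_nhds_zero_iff.1 ?_
  have he : Tendsto (fun k : ℕ => (8 * ‖f‖ + 2 * ‖f‖ * (a + 1) + 2 * ‖f‖ * (b + 1)) *
      (1 / ((k : ℝ) + 1))) atTop (𝓝 0) := by
    simpa using (tendsto_one_div_add_atTop_nhds_zero_nat (𝕜 := ℝ)).const_mul
      (8 * ‖f‖ + 2 * ‖f‖ * (a + 1) + 2 * ‖f‖ * (b + 1))
  refine tendsto_of_forall_eventually_abs_sub_le he fun ω hω => ?_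
  obtain ⟨δ, hδ, hmod⟩ := exists_modulus f hω
  obtain ⟨k0, hk0⟩ := exists_nat_one_div_lt hδ
  filter_upwards [eventually_ge_atTop k0] with k hk
  have hkδ : 1 / ((k : ℝ) + 1) ≤ δ := (Nat.one_div_le_one_div hk).trans hk0.le
  have key := abs_birkhoffSum_two_blocks_sub_le (T := T) (f := f) (ω := ω)
    (fun x y hxy => hmod x y (hxy.trans_le hkδ)) (hz1 k) (hz2 k)
  have hMk : (1 : ℝ) ≤ M k := by exact_mod_cast hM k
  have hLpos : 0 < L k := by simp only [hL]; positivity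
  have n1 : (n k : ℝ) ≤ (1 - t) * L k := Nat.floor_le (by nlinarith)
  have n2 : (1 - t) * L k < n k + 1 := Nat.lt_floor_add_one _
  have m1 : (m k : ℝ) ≤ t * L k := Nat.floor_le (by nlinarith)
  have m2 : t * L k < m k + 1 := Nat.lt_floor_add_one _
  rw [integ_mix, integ_empirical, integ_empirical, integ_empirical,
    Nat.sub_add_cancel (by have := hM k; omega), birkhoffAverage_eq_div _ (_ + _) (z k)]
  set A := birkhoffAverage ℝ T f (a + 1) p
  set B := birkhoffAverage ℝ T f (b + 1) q
  have eA := abs_birkhoffSum_periodic_sub_le f (Nat.succ_pos a) hp (n k)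
  have eB := abs_birkhoffSum_periodic_sub_le f (Nat.succ_pos b) hq (m k)
  have bA : |A| ≤ ‖f‖ := abs_birkhoffAverage_le f _ p
  have bB : |B| ≤ ‖f‖ := abs_birkhoffAverage_le f _ q
  set S := birkhoffSum T f (n k + M k + m k + M k) (z k)
  push_cast at *
  set N : ℝ := Nat.cast (n k)
  set N' : ℝ := Nat.cast (m k)
  set K : ℝ := Nat.cast (M k)
  have hP : L k ≤ N + K + N' + K := by linarith
  have hPpos : 0 < N + K + N' + K := hLpos.trans_le hP
  have hf := norm_nonneg f
  have d1 : |((1 - t) * L k - N) * A| ≤ ‖f‖ := by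
    rw [abs_mul]
    have : |(1 - t) * L k - N| ≤ 1 := abs_le.2 ⟨by linarith, by linarith⟩
    exact (mul_le_mul this bA (abs_nonneg _) zero_le_one).trans (one_mul _).le
  have d2 : |(t * L k - N') * B| ≤ ‖f‖ := by
    rw [abs_mul]
    have : |t * L k - N'| ≤ 1 := abs_le.2 ⟨by linarith, by linarith⟩
    exact (mul_le_mul this bB (abs_nonneg _) zero_le_one).trans (one_mul _).le
  have bC : |(1 - t) * A + t * B| ≤ ‖f‖ := by
    rw [abs_le] at *
    have i1 := mul_le_mul_of_nonneg_left bA.1 (sub_nonneg.2 ht1)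
    have i2 := mul_le_mul_of_nonneg_left bA.2 (sub_nonneg.2 ht1)
    have i3 := mul_le_mul_of_nonneg_left bB.1 ht0
    have i4 := mul_le_mul_of_nonneg_left bB.2 ht0
    constructor <;> linarith
  have d3 : |(N + K + N' + K - L k) * ((1 - t) * A + t * B)| ≤ 2 * K * ‖f‖ := by
    rw [abs_mul, abs_of_nonneg (by linarith)]
    have : N + K + N' + K - L k ≤ 2 * K := by linarith
    exact mul_le_mul this bC (abs_nonneg _) (by linarith)
  have tot : |S - (N + K + N' + K) * ((1 - t) * A + t * B)| ≤
      (N + N') * ω + 4 * K * ‖f‖ + 2 * ‖f‖ + 2 * ‖f‖ * (a + 1) + 2 * ‖f‖ * (b + 1) := by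
    have id : S - (N + K + N' + K) * ((1 - t) * A + t * B) =
      (S - birkhoffSum T f (n k) p - birkhoffSum T f (m k) q) +
      (birkhoffSum T f (n k) p - N * A) + (birkhoffSum T f (m k) q - N' * B) -
      ((1 - t) * L k - N) * A - (t * L k - N') * B -
      (N + K + N' + K - L k) * ((1 - t) * A + t * B) := by ring
    rw [id]
    rw [abs_le] at *
    constructor <;> linarith [key.1, key.2, eA.1, eA.2, eB.1, eB.2, d1.1, d1.2, d2.1, d2.2,
      d3.1, d3.2]
  have hdiv : S / (N + K + N' + K) - ((1 - t) * A + t * B) =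
      (S - (N + K + N' + K) * ((1 - t) * A + t * B)) / (N + K + N' + K) := by
    field_simp
  rw [hdiv, abs_div, abs_of_pos hPpos, div_le_iff₀ hPpos]
  refine tot.trans ?_
  have hk1 : (0 : ℝ) < (k : ℝ) + 1 := by positivity
  have hKle : K ≤ 1 / ((k : ℝ) + 1) * (N + K + N' + K) := by
    rw [one_div, inv_mul_eq_div, le_div_iff₀ hk1]
    calc K * ((k : ℝ) + 1) = L k := by simp only [hL]; ring
      _ ≤ _ := hP
  set e := 1 / ((k : ℝ) + 1)
  have hNN : (N + N') * ω ≤ ω * (N + K + N' + K) := by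
    have : 0 ≤ ω * K := mul_nonneg hω.le (by linarith)
    linarith
  set C := 8 * ‖f‖ + 2 * ‖f‖ * (a + 1) + 2 * ‖f‖ * (b + 1) with hC
  have hC0 : 0 ≤ C := by positivity
  have h1 : C * K ≤ C * (e * (N + K + N' + K)) := mul_le_mul_of_nonneg_left hKle hC0
  have h2 : 4 * K * ‖f‖ + 2 * ‖f‖ + 2 * ‖f‖ * (a + 1) + 2 * ‖f‖ * (b + 1) ≤ C * K := by
    have h3 : ‖f‖ ≤ ‖f‖ * K := le_mul_of_one_le_right hf hMk
    have h4 : ‖f‖ * (a + 1) ≤ ‖f‖ * (a + 1) * K := le_mul_of_one_le_right (by positivity) hMk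
    have h5 : ‖f‖ * (b + 1) ≤ ‖f‖ * (b + 1) * K := le_mul_of_one_le_right (by positivity) hMk
    rw [hC]
    linarith
  linarith

theorem mix_mem_periodicClosure (hspec : BowenSpecification T) (hT : Continuous T)
    (t : unitInterval) {μ ν : ProbabilityMeasure X} (hμ : μ ∈ periodicClosure T)
    (hν : ν ∈ periodicClosure T) : mix t μ ν ∈ periodicClosure T := by
  have hc : Continuous (Function.uncurry fun μ ν : ProbabilityMeasure X => mix t μ ν) :=
    continuous_mix.comp (continuous_const.prodMk continuous_id)
  have := map_mem_closure₂ hc hμ hν (u := periodicClosure T)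
    fun a ha b hb => mix_periodic_mem_closure hspec hT ha hb t
  exact (isClosed_closure (s := periodicMeasures T)).closure_eq.subset this

/-- Long orbit segments can be closed up into periodic orbits at negligible cost. This transfers
averages along arbitrary orbits, hence integrals of invariant measures, to periodic measures. -/
theorem exists_periodicMeasure_near_average (hspec : BowenSpecification T) (hT : Continuous T)
    (f : C(X, ℝ)) {η : ℝ} (hη : 0 < η) : ∃ n₀ : ℕ, ∀ n ≥ n₀, ∀ x, ∃ μ ∈ periodicMeasures T,
      |birkhoffAverage ℝ T f n x - integ μ f| ≤ η := by
  obtain ⟨δ, hδ, hmod⟩ := exists_modulus f (half_pos hη)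
  obtain ⟨M, hM, hz⟩ := hspec.two_blocks hT hδ
  obtain ⟨n₀, hn₀⟩ := exists_nat_gt (4 * M * ‖f‖ / η)
  refine ⟨n₀ + 1, fun n hn x => ?_⟩
  -- The same segment is traversed twice, since the shadowing statement takes two blocks.
  obtain ⟨z, hper, h1, h2⟩ := hz x x n n
  refine ⟨empirical T z (n + M + n + M - 1), ⟨z, _, ?_, rfl⟩, ?_⟩
  · rwa [Nat.sub_add_cancel (by omega)]
  have key := abs_birkhoffSum_two_blocks_sub_le (T := T) hmod h1 h2
  have bA := abs_birkhoffAverage_le (T := T) f n x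
  have hn1 : (n₀ : ℝ) + 1 ≤ n := by exact_mod_cast hn
  have hnpos : (0 : ℝ) < n := by linarith [Nat.cast_nonneg (α := ℝ) n₀]
  have hS : birkhoffSum T f n x = n * birkhoffAverage ℝ T f n x := by
    rw [birkhoffAverage_eq_div]; field_simp
  rw [integ_empirical, Nat.sub_add_cancel (by omega), birkhoffAverage_eq_div _ (_ + _) z,
    abs_sub_comm]
  rw [hS] at key
  set A := birkhoffAverage ℝ T f n x
  set S := birkhoffSum T f (n + M + n + M) z
  have hM' : (1 : ℝ) ≤ M := by exact_mod_cast hM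
  push_cast
  have hP : (0 : ℝ) < n + M + n + M := by positivity
  have hdiv : S / (n + M + n + M) - A = (S - (n + M + n + M) * A) / (n + M + n + M) := by
    field_simp
  rw [hdiv, abs_div, abs_of_pos hP, div_le_iff₀ hP]
  have d : |2 * M * A| ≤ 2 * M * ‖f‖ := by
    rw [abs_mul, abs_of_nonneg (by positivity)]
    exact mul_le_mul_of_nonneg_left bA (by positivity)
  have hb : 4 * M * ‖f‖ ≤ η * n := by
    have := (div_lt_iff₀ hη).1 (hn₀.trans (by linarith : (n₀ : ℝ) < n))
    linarith
  have id : S - (n + M + n + M) * A = (S - n * A - n * A) - 2 * M * A := by ring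
  rw [id]
  have : 0 ≤ η * M := by positivity
  rw [abs_le] at *
  constructor <;> linarith [key.1, key.2, d.1, d.2]

theorem periodicMeasures_subset_closure : periodicMeasures T ⊆ periodicClosure T := subset_closure

/-- Equality of `∫ f ∘ T` and `∫ f` is a weak-* closed condition, and on a periodic orbit the two
sums are cyclic shifts of each other. -/
theorem periodicClosure_subset_invariantMeasures (hT : Continuous T) :
    periodicClosure T ⊆ invariantMeasures T := by
  have hinv : ∀ f : C(X, ℝ), ∀ μ ∈ periodicClosure T,
      integ μ (f.comp ⟨T, hT⟩) = integ μ f := by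
    intro f
    refine closure_minimal (t := {μ | integ μ (f.comp ⟨T, hT⟩) = integ μ f}) ?_
      (isClosed_eq (continuous_integ _) (continuous_integ _))
    rintro _ ⟨q, n, hq, rfl⟩
    simp only [Set.mem_ofPred_eq, integ_empirical, birkhoffAverage, birkhoffSum]
    congr 1
    have h1 := Finset.sum_range_succ (fun k => f (T^[k] q)) (n + 1)
    have h2 := Finset.sum_range_succ' (fun k => f (T^[k] q)) (n + 1)
    rw [hq] at h1
    simp only [Function.iterate_zero, id] at h2
    simp only [ContinuousMap.comp_apply, ContinuousMap.coe_mk, ← Function.iterate_succ_apply']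
    linarith
  intro μ hμ
  refine ⟨hT.measurable, ?_⟩
  have : IsFiniteMeasure (Measure.map T (μ : Measure X)) := inferInstance
  refine ext_of_forall_integral_eq_of_IsFiniteMeasure fun f => ?_
  rw [integral_map hT.aemeasurable f.continuous.aestronglyMeasurable]
  exact hinv f.toContinuousMap μ hμ

theorem exists_periodicMeasure_charging (hspec : BowenSpecification T) (y : X) {r : ℝ}
    (hr : 0 < r) : ∃ μ ∈ periodicMeasures T, 0 < integ μ (bump y r) := by
  obtain ⟨q, n, hq, hd⟩ := hspec.dense_periodic y hr
  refine ⟨_, ⟨q, n, hq, rfl⟩, ?_⟩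
  rw [integ_empirical, birkhoffAverage_eq_div]
  refine div_pos ?_ (by positivity)
  exact Finset.sum_pos' (fun i _ => bump_nonneg _ _ _) ⟨0, by simp, bump_pos hd⟩

/-- The measure `μ` is carried by a finite forward invariant set. -/
def FinitelySupported (T : X → X) (μ : ProbabilityMeasure X) : Prop :=
  ∃ F : Set X, F.Finite ∧ F.Nonempty ∧ Set.MapsTo T F F ∧ (μ : Measure X) Fᶜ = 0

theorem finitelySupported_of_mem_periodicMeasures {μ : ProbabilityMeasure X}
    (hμ : μ ∈ periodicMeasures T) : FinitelySupported T μ := by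
  obtain ⟨q, n, hq, rfl⟩ := hμ
  refine ⟨Set.range fun i => T^[i] q, finite_orbit_of_periodic hq, ⟨_, ⟨0, rfl⟩⟩, ?_, ?_⟩
  · rintro _ ⟨i, rfl⟩
    exact ⟨i + 1, Function.iterate_succ_apply' T i q⟩
  · have hm := (finite_orbit_of_periodic hq).isClosed.measurableSet.compl
    simp only [empirical, ProbabilityMeasure.coe_mk, Measure.smul_apply,
      Measure.finsetSum_apply, smul_eq_mul, mul_eq_zero]
    right
    refine Finset.sum_eq_zero fun i _ => ?_
    rw [Measure.dirac_apply' _ hm]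
    simp

theorem FinitelySupported.mix {μ ν : ProbabilityMeasure X} (hμ : FinitelySupported T μ)
    (hν : FinitelySupported T ν) (t : unitInterval) : FinitelySupported T (mix t μ ν) := by
  obtain ⟨F, hF, hne, hFT, hFμ⟩ := hμ
  obtain ⟨G, hG, -, hGT, hGν⟩ := hν
  refine ⟨F ∪ G, hF.union hG, hne.inl, hFT.union_union hGT, mix_null ?_ ?_⟩
  · exact measure_mono_null (Set.compl_subset_compl.2 Set.subset_union_left) hFμ
  · exact measure_mono_null (Set.compl_subset_compl.2 Set.subset_union_right) hGν

end Periodic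

/-! ### Gluing infinitely many periodic orbit segments -/

section Tracking

variable {X : Type*} [MetricSpace X] [CompactSpace X] {T : X → X}

theorem abs_birkhoffSum_sub_le_of_shadows_periodic {f : C(X, ℝ)} {ε ω : ℝ} (hω0 : 0 ≤ ω)
    (hω : ∀ a b : X, dist a b < ε → |f a - f b| ≤ ω) {y q : X} {M L P : ℕ} (hP : 0 < P)
    (hq : T^[P] q = q) (h : ∀ j ≤ L, dist (T^[M + j] y) (T^[j] q) < ε) {n : ℕ} (hn : n ≤ M + L) :
    |birkhoffSum T f n y - n * birkhoffAverage ℝ T f P q| ≤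
      2 * ‖f‖ * (M + P) + n * ω := by
  have bA := abs_birkhoffAverage_le (T := T) f P q
  have hf := norm_nonneg f
  rcases le_total n M with hnM | hnM
  · have h1 := abs_birkhoffSum_le (T := T) f n y
    have h2 : (n : ℝ) * ‖f‖ ≤ M * ‖f‖ :=
      mul_le_mul_of_nonneg_right (by exact_mod_cast hnM) hf
    have h3 : |(n : ℝ) * birkhoffAverage ℝ T f P q| ≤ n * ‖f‖ := by
      rw [abs_mul, Nat.abs_cast]
      exact mul_le_mul_of_nonneg_left bA (Nat.cast_nonneg n)
    have h4 : 0 ≤ ‖f‖ * P := by positivity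
    have h5 : 0 ≤ n * ω := by positivity
    refine (abs_sub _ _).trans ?_
    linarith
  · obtain ⟨t, rfl⟩ := Nat.exists_eq_add_of_le hnM
    rw [birkhoffSum_add]
    have h1 := abs_birkhoffSum_le (T := T) f M y
    have h2 := abs_birkhoffSum_sub_le (T := T) hω (n := t) (u := T^[M] y) (v := q)
      fun i hi => by
        rw [← Function.iterate_add_apply, add_comm i]
        exact h i (by omega)
    have h3 := abs_birkhoffSum_periodic_sub_le f hP hq t
    have h4 : |(M : ℝ) * birkhoffAverage ℝ T f P q| ≤ M * ‖f‖ := by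
      rw [abs_mul, Nat.abs_cast]
      exact mul_le_mul_of_nonneg_left bA (Nat.cast_nonneg M)
    have h5 : 0 ≤ (M : ℝ) * ω := by positivity
    push_cast
    rw [abs_le] at *
    constructor <;> linarith [h1.1, h1.2, h2.1, h2.2, h3.1, h3.2, h4.1, h4.2]

/-- The end of the `n`-th block in the gluing construction with gaps `M` and periods `P`. -/
def blockEnd (M P : ℕ → ℕ) : ℕ → ℕ
  | 0 => 0
  | n + 1 => blockEnd M P n + M n +
      (n + 1) * (blockEnd M P n + M n + P n + M (n + 1) + P (n + 1) + 1)

theorem blockEnd_strictMono (M P : ℕ → ℕ) : StrictMono (blockEnd M P) := by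
  refine strictMono_nat_of_lt_succ fun n => ?_
  rw [blockEnd]
  have : 0 < (n + 1) * (blockEnd M P n + M n + P n + M (n + 1) + P (n + 1) + 1) := by positivity
  omega

/-- Why blocks have this length: the end of a block exceeds, by a factor `n + 1`, the whole past
with its gap and period, and also the gap and period of the next block. So the past is forgotten by
the end of a block, and starting a new one is cheap. -/
theorem le_blockEnd (M P : ℕ → ℕ) (n : ℕ) :
    (n + 1) * (blockEnd M P n + M n + P n) ≤ blockEnd M P (n + 1) ∧
    (n + 1) * (M (n + 1) + P (n + 1)) ≤ blockEnd M P (n + 1) := by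
  rw [blockEnd]
  constructor <;> nlinarith

/-- Successive points shadow the previous one up to the last block end and then a new periodic
orbit. Precisions are halved each time, so the points converge and the limit inherits all the
blocks. -/
theorem exists_glued_point (hspec : BowenSpecification T) (hT : Continuous T) (x₀ : X) {r : ℝ}
    (hr : 0 < r) (q : ℕ → X) (P : ℕ → ℕ) : ∃ (x : X) (M : ℕ → ℕ), dist x₀ x ≤ r ∧
      ∀ n, ∀ j ≤ (n + 1) * (blockEnd M P n + M n + P n + M (n + 1) + P (n + 1) + 1),
        dist (T^[blockEnd M P n + M n + j] x) (T^[j] (q n)) < 2 * (r / 2 ^ n) := by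
  have hε : ∀ n : ℕ, 0 < r / 2 / 2 ^ n := fun n => by positivity
  choose M hM Z hper hZ1 hZ2 using fun n => hspec.two_blocks hT (hε n)
  set S := blockEnd M P
  set L : ℕ → ℕ := fun n => (n + 1) * (S n + M n + P n + M (n + 1) + P (n + 1) + 1) with hL
  let z : ℕ → X := fun n => Nat.rec x₀ (fun n u => Z n u (q n) (S n) (L n)) n
  have hz1 : ∀ n, ∀ j ≤ S n, dist (T^[j] (z (n + 1))) (T^[j] (z n)) < r / 2 / 2 ^ n :=
    fun n => hZ1 n (z n) (q n) (S n) (L n)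
  have hz2 : ∀ n, ∀ j ≤ L n, dist (T^[S n + M n + j] (z (n + 1))) (T^[j] (q n)) < r / 2 / 2 ^ n :=
    fun n => hZ2 n (z n) (q n) (S n) (L n)
  have hz0 : ∀ n, dist (z n) (z (n + 1)) ≤ r / 2 / 2 ^ n := fun n => by
    rw [dist_comm]; exact (hz1 n 0 (Nat.zero_le _)).le
  obtain ⟨x, hx⟩ := cauchySeq_tendsto_of_complete (cauchySeq_of_le_geometric_two hz0)
  refine ⟨x, M, dist_le_of_le_geometric_two_of_tendsto₀ hz0 hx, fun n j hj => ?_⟩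
  have hmono := (blockEnd_strictMono M P).monotone
  have hSn : S n + M n + j ≤ S (n + 1) := by
    have : S (n + 1) = S n + M n + L n := rfl
    have : j ≤ L n := hj
    omega
  set i := S n + M n + j
  have hlim : Tendsto (fun k => T^[i] (z (k + (n + 1)))) atTop (𝓝 (T^[i] x)) :=
    ((hT.iterate i).tendsto x).comp (hx.comp (tendsto_add_atTop_nat (n + 1)))
  -- Later corrections leave times up to `S (n + 1)` almost untouched; their errors form the
  -- geometric tail.
  have hclose : dist (T^[i] (z (0 + (n + 1)))) (T^[i] x) ≤ r / 2 ^ (n + 1) := by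
    refine dist_le_of_le_geometric_two_of_tendsto₀ (fun k => ?_) hlim
    rw [dist_comm]
    have := (hz1 (k + (n + 1)) i (hSn.trans (hmono (by omega)))).le
    rw [show k + (n + 1) + 1 = k + 1 + (n + 1) by ring] at this
    refine this.trans (le_of_eq ?_)
    rw [pow_add]
    field_simp
  rw [zero_add] at hclose
  have h2 := hz2 n j hj
  have h3 := dist_triangle_left (T^[i] x) (T^[j] (q n)) (T^[i] (z (n + 1)))
  have h4 : r / 2 ^ (n + 1) = r / 2 / 2 ^ n := by rw [pow_succ]; field_simp
  have h5 : r / 2 ^ n = 2 * (r / 2 / 2 ^ n) := by field_simp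
  have h6 := hε n
  linarith

end Tracking

/-! ### Points with prescribed asymptotic empirical measures -/

section Glue

variable {X : Type*} [MetricSpace X] [CompactSpace X] [MeasurableSpace X] [BorelSpace X]
  {T : X → X}

/-- The space of probability measures is compact and metrizable, so integration of a fixed `f` is
uniformly continuous; approximating `μ j` within `1 / (j + 1)` serves every `f` at once. -/
theorem exists_periodic_approximation {μ : ℕ → ProbabilityMeasure X}
    (hμ : ∀ j, μ j ∈ periodicClosure T) : ∃ ν : ℕ → ProbabilityMeasure X,
      (∀ j, ν j ∈ periodicMeasures T) ∧
      ∀ f, Tendsto (fun j => |integ (ν j) f - integ (μ j) f|) atTop (𝓝 0) := by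
  let _ := TopologicalSpace.metrizableSpaceMetric (ProbabilityMeasure X)
  have : ∀ j : ℕ, ∃ ν ∈ periodicMeasures T, dist (μ j) ν < 1 / ((j : ℝ) + 1) := fun j =>
    Metric.mem_closure_iff.1 (hμ j) _ Nat.one_div_pos_of_nat
  choose ν hν hd using this
  refine ⟨ν, hν, fun f => ?_⟩
  rw [Metric.tendsto_nhds]
  intro δ hδ
  obtain ⟨η, hη, h⟩ := Metric.uniformContinuous_iff.1
    (CompactSpace.uniformContinuous_of_continuous (continuous_integ f)) δ hδ
  filter_upwards [(tendsto_one_div_add_atTop_nhds_zero_nat (𝕜 := ℝ)).eventually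
    (gt_mem_nhds hη)] with j hj
  have := h ((dist_comm _ _).trans_lt ((hd j).trans hj))
  simpa [Real.dist_eq] using this

/-- At block ends the past is negligible, so the average is that of the latest orbit. Inside a block
it is the average at the last block end mixed with that of the current orbit, weighted by elapsed
time. -/
theorem exists_tracking_point (hspec : BowenSpecification T) (hT : Continuous T) {U : Set X}
    (hU : IsOpen U) (hne : U.Nonempty) {μ : ℕ → ProbabilityMeasure X}
    (hμ : ∀ j, μ j ∈ periodicClosure T) :
    ∃ x ∈ U, ∃ N : ℕ → ℕ, StrictMono N ∧ ∃ (k : ℕ → ℕ) (θ : ℕ → unitInterval),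
      ∀ f : C(X, ℝ),
        Tendsto (fun j => birkhoffAverage ℝ T f (N j) x - integ (μ j) f) atTop (𝓝 0) ∧
        Tendsto (fun n => birkhoffAverage ℝ T f n x -
          integ (mix (θ n) (μ (k n)) (μ (k n + 1))) f) atTop (𝓝 0) := by
  obtain ⟨ν, hν, happ⟩ := exists_periodic_approximation hμ
  choose q p hq hνq using hν
  obtain ⟨x₀, hx₀⟩ := hne
  obtain ⟨r, hr, hrU⟩ := Metric.isOpen_iff.1 hU x₀ hx₀
  obtain ⟨x, M, hx, htrack⟩ := exists_glued_point hspec hT x₀ (half_pos hr) q (fun n => p n + 1)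
  set P : ℕ → ℕ := fun n => p n + 1
  set S := blockEnd M P with hS
  have hSm : StrictMono S := blockEnd_strictMono M P
  -- `θ` is the share of the time `n` spent after the last block end `S (k + 1)`; before `S 1` the
  -- values are arbitrary.
  have hθ : ∀ n, ∃ (k : ℕ) (θ : unitInterval), S 1 ≤ n →
      S (k + 1) ≤ n ∧ n < S (k + 2) ∧ (θ : ℝ) * n = n - S (k + 1) := by
    intro n
    by_cases hn : S 1 ≤ n
    · have hex : ∃ k, n < S (k + 2) := ⟨n, lt_of_lt_of_le (by omega) (hSm.le_apply (x := n + 2))⟩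
      classical
      have hk := Nat.find_spec hex
      have hk' : S (Nat.find hex + 1) ≤ n := by
        rcases Nat.eq_zero_or_pos (Nat.find hex) with h | h
        · rwa [h]
        · have := Nat.find_min hex (Nat.sub_one_lt_of_lt h)
          rw [show Nat.find hex - 1 + 2 = Nat.find hex + 1 by omega] at this
          exact not_lt.1 this
      have hnpos : (0 : ℝ) < n := by
        have : S 0 < S 1 := hSm Nat.zero_lt_one
        exact_mod_cast (Nat.zero_le _).trans_lt (this.trans_le hn)
      have hk'' : (S (Nat.find hex + 1) : ℝ) ≤ n := by exact_mod_cast hk'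
      refine ⟨Nat.find hex, ⟨(n - S (Nat.find hex + 1)) / n, by
        constructor
        · exact div_nonneg (by linarith) hnpos.le
        · rw [div_le_one hnpos]; linarith [Nat.cast_nonneg (α := ℝ) (S (Nat.find hex + 1))]⟩,
        fun _ => ⟨hk', hk, ?_⟩⟩
      field_simp
    · exact ⟨0, 0, fun h => absurd h hn⟩
  choose k θ hkθ using hθ
  have hktop : Tendsto k atTop atTop := by
    refine tendsto_atTop.2 fun b => ?_
    filter_upwards [eventually_ge_atTop (S (b + 2))] with n hn
    have h1 := (hkθ n ((hSm.monotone (by omega)).trans hn)).2.1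
    have := hSm.lt_iff_lt.1 (hn.trans_lt h1)
    omega
  refine ⟨x, hrU ?_, fun j => S (j + 1), fun a b hab => hSm (by omega), k, θ, fun f => ?_⟩
  · rw [Metric.mem_ball, dist_comm]; linarith
  set c : ℕ → ℝ := fun n => birkhoffAverage ℝ T f (P n) (q n) with hc
  have hcν : ∀ n, integ (ν n) f = c n := fun n => by rw [hνq, integ_empirical]
  have hF := norm_nonneg f
  have hshadow : ∀ ω : ℝ, 0 < ω → ∀ᶠ n in atTop, ∀ m, S n ≤ m → m ≤ S (n + 1) →
      |birkhoffSum T f m x - birkhoffSum T f (S n) x - (m - S n) * c n| ≤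
        2 * ‖f‖ * (M n + P n) + m * ω := by
    intro ω hω
    obtain ⟨ε, hε, hmod⟩ := exists_modulus f hω
    have hlim : Tendsto (fun n : ℕ => 2 * (r / 2 / 2 ^ n)) atTop (𝓝 0) := by
      have := (tendsto_pow_atTop_nhds_zero_of_lt_one (r := (1 / 2 : ℝ)) (by norm_num)
        (by norm_num)).const_mul r
      rw [mul_zero] at this
      refine this.congr fun n => ?_
      rw [one_div, inv_pow]
      field_simp
    filter_upwards [hlim.eventually (gt_mem_nhds hε)] with n hn m hm1 hm2
    obtain ⟨t, rfl⟩ := Nat.exists_eq_add_of_le hm1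
    have hSn : S (n + 1) = S n + M n + (n + 1) * (S n + M n + P n + M (n + 1) + P (n + 1) + 1) :=
      rfl
    have key := abs_birkhoffSum_sub_le_of_shadows_periodic (T := T) (y := T^[S n] x) hω.le
      (fun a b hab => hmod a b (hab.trans hn)) (Nat.succ_pos (p n)) (hq n) (M := M n)
      (L := (n + 1) * (S n + M n + P n + M (n + 1) + P (n + 1) + 1)) (fun j hj => by
        rw [← Function.iterate_add_apply, show M n + j + S n = S n + M n + j by ring]
        exact htrack n j hj) (n := t) (by omega)
    rw [birkhoffSum_add]
    push_cast
    have h1 : 0 ≤ (S n : ℝ) * ω := by positivity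
    have e1 : birkhoffSum T f (S n) x + birkhoffSum T f t (T^[S n] x) - birkhoffSum T f (S n) x -
      ((S n : ℝ) + t - S n) * c n = birkhoffSum T f t (T^[S n] x) - t * c n := by ring
    rw [e1]
    have e2 : ((Nat.succ (p n) : ℕ) : ℝ) = P n := rfl
    rw [e2] at key
    refine key.trans ?_
    linarith
  have hSpos : ∀ n, (0 : ℝ) < S (n + 1) := fun n => by
    exact_mod_cast (Nat.zero_le _).trans_lt (hSm (Nat.lt_succ_self n))
  have hend : ∀ ω : ℝ, 0 < ω → ∀ᶠ n in atTop,
      |birkhoffSum T f (S (n + 1)) x - S (n + 1) * c n| ≤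
        (ω + 2 * ‖f‖ * (1 / ((n : ℝ) + 1))) * S (n + 1) := by
    intro ω hω
    filter_upwards [hshadow ω hω] with n hn
    have h1 := hn (S (n + 1)) (hSm.monotone (Nat.le_succ n)) le_rfl
    have h2 := abs_birkhoffSum_le (T := T) f (S n) x
    have h3 : |(S n : ℝ) * c n| ≤ S n * ‖f‖ := by
      rw [abs_mul, Nat.abs_cast]
      exact mul_le_mul_of_nonneg_left (abs_birkhoffAverage_le f _ _) (Nat.cast_nonneg _)
    have h4 : ((S n : ℝ) + M n + P n) ≤ 1 / ((n : ℝ) + 1) * S (n + 1) := by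
      rw [one_div, inv_mul_eq_div, le_div_iff₀ (by positivity), mul_comm]
      exact_mod_cast (le_blockEnd M P n).1
    have h5 := mul_le_mul_of_nonneg_left h4 (by positivity : 0 ≤ 2 * ‖f‖)
    rw [abs_le] at *
    constructor <;> linarith [h1.1, h1.2, h2.1, h2.2, h3.1, h3.2]
  constructor
  · have he : Tendsto (fun n : ℕ => 2 * ‖f‖ * (1 / ((n : ℝ) + 1)) +
        |integ (ν n) f - integ (μ n) f|) atTop (𝓝 0) := by
      simpa using ((tendsto_one_div_add_atTop_nhds_zero_nat (𝕜 := ℝ)).const_mul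
        (2 * ‖f‖)).add (happ f)
    refine tendsto_of_forall_eventually_abs_sub_le he fun ω hω => ?_
    filter_upwards [hend ω hω] with n hn
    have h1 : |birkhoffAverage ℝ T f (S (n + 1)) x - c n| ≤
        ω + 2 * ‖f‖ * (1 / ((n : ℝ) + 1)) := by
      have : birkhoffAverage ℝ T f (S (n + 1)) x - c n =
          (birkhoffSum T f (S (n + 1)) x - S (n + 1) * c n) / S (n + 1) := by
        have := (hSpos n).ne'
        rw [birkhoffAverage_eq_div]
        field_simp
      rw [this, abs_div, abs_of_pos (hSpos n), div_le_iff₀ (hSpos n)]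
      exact hn
    have h2 := abs_sub_le (birkhoffAverage ℝ T f (S (n + 1)) x) (c n) (integ (μ n) f)
    rw [hcν]
    linarith
  · have he : Tendsto (fun n : ℕ => 4 * ‖f‖ * (1 / ((k n : ℝ) + 1)) +
        |integ (ν (k n)) f - integ (μ (k n)) f| +
        |integ (ν (k n + 1)) f - integ (μ (k n + 1)) f|) atTop (𝓝 0) := by
      simpa using ((((tendsto_one_div_add_atTop_nhds_zero_nat (𝕜 := ℝ)).comp hktop).const_mul
        (4 * ‖f‖)).add ((happ f).comp hktop)).add
        ((happ f).comp ((tendsto_add_atTop_nat 1).comp hktop))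
    refine tendsto_of_forall_eventually_abs_sub_le he fun ω hω => ?_
    filter_upwards [hktop.eventually (hend (ω / 2) (half_pos hω)),
      ((tendsto_add_atTop_nat 1).comp hktop).eventually (hshadow (ω / 2) (half_pos hω)),
      eventually_ge_atTop (S 1)] with n h1 h2 hn
    obtain ⟨g1, g2, g3⟩ := hkθ n hn
    have h2 := h2 n g1 g2.le
    simp only [Function.comp_apply] at h2
    have hnpos : (0 : ℝ) < n := (hSpos _).trans_le (by exact_mod_cast hn : (S (0 + 1) : ℝ) ≤ n)
    have g1' : (S (k n + 1) : ℝ) ≤ n := by exact_mod_cast g1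
    rw [integ_mix]
    set κ := k n
    set A := birkhoffAverage ℝ T f n x with hA
    have hsum : birkhoffSum T f n x = n * A := by
      rw [hA, birkhoffAverage_eq_div]; field_simp
    rw [hsum] at h2
    have h4 : ((M (κ + 1) : ℝ) + P (κ + 1)) ≤ 1 / ((κ : ℝ) + 1) * S (κ + 1) := by
      rw [one_div, inv_mul_eq_div, le_div_iff₀ (by positivity), mul_comm]
      exact_mod_cast (le_blockEnd M P κ).2
    set e := 1 / ((κ : ℝ) + 1)
    have he0 : 0 ≤ e := by positivity
    have h5 := mul_le_mul_of_nonneg_left h4 (by positivity : 0 ≤ 2 * ‖f‖)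
    have h6 : (ω / 2 + 4 * ‖f‖ * e) * S (κ + 1) ≤ (ω / 2 + 4 * ‖f‖ * e) * n :=
      mul_le_mul_of_nonneg_left g1' (by positivity)
    have h7 : |A - ((1 - θ n) * c κ + θ n * c (κ + 1))| ≤ ω + 4 * ‖f‖ * e := by
      refine le_of_mul_le_mul_right ?_ hnpos
      have h8 : |A - ((1 - θ n) * c κ + θ n * c (κ + 1))| * n =
          |n * A - S (κ + 1) * c κ - (n - S (κ + 1)) * c (κ + 1)| := by
        rw [← abs_of_pos hnpos, ← abs_mul, abs_of_pos hnpos]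
        congr 1
        have g4 : (S (κ + 1) : ℝ) = n - θ n * n := by linarith
        rw [g4]
        ring
      rw [h8]
      rw [abs_le] at h1 h2 ⊢
      constructor <;> linarith [h1.1, h1.2, h2.1, h2.2]
    have h9 : |((1 - (θ n : ℝ)) * c κ + θ n * c (κ + 1)) -
        ((1 - θ n) * integ (μ κ) f + θ n * integ (μ (κ + 1)) f)| ≤
        |c κ - integ (μ κ) f| + |c (κ + 1) - integ (μ (κ + 1)) f| := by
      have t0 := (θ n).2.1
      have t1 := (θ n).2.2
      have : ((1 - (θ n : ℝ)) * c κ + θ n * c (κ + 1)) -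
        ((1 - θ n) * integ (μ κ) f + θ n * integ (μ (κ + 1)) f) =
        (1 - θ n) * (c κ - integ (μ κ) f) + θ n * (c (κ + 1) - integ (μ (κ + 1)) f) := by ring
      rw [this]
      refine (abs_add_le _ _).trans (add_le_add ?_ ?_)
      · rw [abs_mul, abs_of_nonneg (by linarith)]
        exact mul_le_of_le_one_left (abs_nonneg _) (by linarith)
      · rw [abs_mul, abs_of_nonneg t0]
        exact mul_le_of_le_one_left (abs_nonneg _) t1
    rw [hcν, hcν]
    refine (abs_sub_le _ ((1 - θ n) * c κ + θ n * c (κ + 1)) _).trans ?_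
    linarith

/-- The orbit of `x` comes back to each `κ m` infinitely often, in the sense of empirical
measures, and these measures are asymptotic to convex combinations of two of the `κ m`. -/
def IsGlued (T : X → X) (κ : ℕ → ProbabilityMeasure X) (x : X) : Prop :=
  (∀ m, ∃ s : ℕ → ℕ, StrictMono s ∧
    ∀ f : C(X, ℝ), Tendsto (fun j => birkhoffAverage ℝ T f (s j) x) atTop (𝓝 (integ (κ m) f))) ∧
  ∃ (i i' : ℕ → ℕ) (θ : ℕ → unitInterval), ∀ f : C(X, ℝ),
    Tendsto (fun n => birkhoffAverage ℝ T f n x - integ (mix (θ n) (κ (i n)) (κ (i' n))) f)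
      atTop (𝓝 0)

/-- Track the sequence `κ j.unpair.1`, in which each `κ m` recurs at all indices `Nat.pair m j`. -/
theorem exists_isGlued (hspec : BowenSpecification T) (hT : Continuous T) {U : Set X}
    (hU : IsOpen U) (hne : U.Nonempty) {κ : ℕ → ProbabilityMeasure X}
    (hκ : ∀ j, κ j ∈ periodicClosure T) : ∃ x ∈ U, IsGlued T κ x := by
  obtain ⟨x, hx, N, hN, k, θ, h⟩ := exists_tracking_point hspec hT hU hne
    (μ := fun j => κ j.unpair.1) fun j => hκ _
  refine ⟨x, hx, fun m => ⟨fun j => N (Nat.pair m j),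
    hN.comp fun a b hab => Nat.pair_lt_pair_right m hab, fun f => ?_⟩, _, _, θ, fun f => (h f).2⟩
  have hp : Tendsto (fun j => Nat.pair m j) atTop atTop :=
    StrictMono.tendsto_atTop fun a b hab => Nat.pair_lt_pair_right m hab
  refine tendsto_sub_nhds_zero_iff.1 (((h f).1.comp hp).congr fun j => ?_)
  simp [Nat.unpair_pair]

end Glue

/-! ### Rich families and generic full support -/

section Baire

variable {X : Type*} [MetricSpace X] [CompactSpace X] [MeasurableSpace X] [BorelSpace X]
  {T : X → X}

/-- A closed convex set of limits of periodic measures, such that each open set is charged by a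
finitely supported member. -/
structure IsRich (T : X → X) (𝒞 : Set (ProbabilityMeasure X)) : Prop where
  isClosed : IsClosed 𝒞
  subset : 𝒞 ⊆ periodicClosure T
  mix_mem : ∀ (t : unitInterval) {μ ν : ProbabilityMeasure X}, μ ∈ 𝒞 → ν ∈ 𝒞 → mix t μ ν ∈ 𝒞
  exists_charging : ∀ (y : X) (r : ℝ), 0 < r →
    ∃ ρ ∈ 𝒞, FinitelySupported T ρ ∧ 0 < integ ρ (bump y r)

theorem tendsto_mix_zero (μ : ProbabilityMeasure X) (ν : ℕ → ProbabilityMeasure X)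
    {t : ℕ → unitInterval} (ht : Tendsto t atTop (𝓝 0)) :
    Tendsto (fun n => mix (t n) μ (ν n)) atTop (𝓝 μ) := by
  refine tendsto_iff_integ.2 fun f => tendsto_sub_nhds_zero_iff.1 ?_
  have ht' : Tendsto (fun n => (t n : ℝ) * (2 * ‖f‖)) atTop (𝓝 0) := by
    simpa using ((continuous_subtype_val.tendsto _).comp ht).mul_const (2 * ‖f‖)
  refine squeeze_zero_norm (fun n => ?_) ht'
  have h1 := abs_integ_le μ f
  have h2 := abs_integ_le (ν n) f
  have e : integ (mix (t n) μ (ν n)) f - integ μ f = t n * (integ (ν n) f - integ μ f) := by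
    rw [integ_mix]; ring
  rw [e, Real.norm_eq_abs, abs_mul, abs_of_nonneg (t n).2.1]
  exact mul_le_mul_of_nonneg_left ((abs_sub _ _).trans (by linarith)) (t n).2.1

/-- The weights `1 / (n + 1)`. -/
noncomputable def harmonicWeight (n : ℕ) : unitInterval :=
  ⟨1 / ((n : ℝ) + 1), by positivity, by
    rw [div_le_one (by positivity)]; linarith [Nat.cast_nonneg (α := ℝ) n]⟩

theorem tendsto_harmonicWeight : Tendsto harmonicWeight atTop (𝓝 0) :=
  tendsto_subtype_rng.2 (tendsto_one_div_add_atTop_nhds_zero_nat (𝕜 := ℝ))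

theorem IsRich.exists_full_support [Nonempty X] {𝒞 : Set (ProbabilityMeasure X)}
    (h𝒞 : IsRich T 𝒞) {ι : Type*} [Countable ι] {G : ι → Set (ProbabilityMeasure X)}
    (hG : ∀ i, IsOpen (G i)) (hd : ∀ i, 𝒞 ⊆ closure (G i ∩ 𝒞)) :
    ∃ μ ∈ 𝒞, (∀ y r, 0 < r → 0 < integ μ (bump y r)) ∧ ∀ i, μ ∈ G i := by
  obtain ⟨c, s, hs, hcs⟩ := exists_countable_bumps X
  have hcomp : CompactSpace 𝒞 := isCompact_iff_compactSpace.1 h𝒞.isClosed.isCompact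
  let W : ℕ ⊕ ι → Set (ProbabilityMeasure X) :=
    Sum.elim (fun i => {μ | 0 < integ μ (bump (c i) (s i))}) G
  have hWo : ∀ i, IsOpen (W i) := by
    rintro (i | i)
    · exact isOpen_lt continuous_const (continuous_integ _)
    · exact hG i
  have hWd : ∀ i, 𝒞 ⊆ closure (W i ∩ 𝒞) := by
    rintro (i | i)
    · intro μ hμ
      obtain ⟨ρ, hρ, -, hpos⟩ := h𝒞.exists_charging (c i) (s i) (hs i)
      refine mem_closure_of_tendsto (tendsto_mix_zero μ (fun _ => ρ) tendsto_harmonicWeight)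
        (Eventually.of_forall fun n => ⟨?_, h𝒞.mix_mem _ hμ hρ⟩)
      change 0 < integ _ _
      rw [integ_mix]
      have h1 := integ_nonneg μ (bump_nonneg (c i) (s i))
      have h2 := (harmonicWeight n).2.2
      have h3 : 0 < ((harmonicWeight n : unitInterval) : ℝ) := by
        simp only [harmonicWeight]; positivity
      have h4 : 0 ≤ (1 - (harmonicWeight n : ℝ)) * integ μ (bump (c i) (s i)) :=
        mul_nonneg (by linarith) h1
      have h5 := mul_pos h3 hpos
      linarith
    · exact hd i
  obtain ⟨ρ, hρ, -⟩ := h𝒞.exists_charging (Classical.arbitrary X) 1 one_pos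
  have hne : Nonempty 𝒞 := ⟨⟨ρ, hρ⟩⟩
  have hdense : Dense (⋂ i, (Subtype.val : 𝒞 → _) ⁻¹' W i) := by
    refine dense_iInter_of_isOpen (fun i => (hWo i).preimage continuous_subtype_val) fun i => ?_
    rw [Subtype.dense_iff, Subtype.image_preimage_coe, Set.inter_comm]
    exact hWd i
  obtain ⟨⟨μ, hμ⟩, hmem⟩ := hdense.nonempty
  rw [Set.mem_iInter] at hmem
  refine ⟨μ, hμ, fun y r hr => ?_, fun i => hmem (Sum.inr i)⟩
  obtain ⟨i, hi⟩ := hcs y r hr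
  have : 0 < integ μ (bump (c i) (s i)) := hmem (Sum.inl i)
  exact this.trans_le (integ_mono μ hi)

end Baire

/-! ### Existence of an ergodic measure of full support -/

section Ergodic

variable {X : Type*} [MetricSpace X] [CompactSpace X] [MeasurableSpace X] [BorelSpace X]
  {T : X → X}

/-- The Birkhoff average of a continuous function as a continuous function. -/
noncomputable def averageMap (hT : Continuous T) (f : C(X, ℝ)) (m : ℕ) : C(X, ℝ) :=
  ⟨fun x => birkhoffAverage ℝ T f m x, by
    simp only [birkhoffAverage, birkhoffSum, smul_eq_mul]
    exact continuous_const.mul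
      (continuous_finsetSum _ fun i _ => f.continuous.comp (hT.iterate i))⟩

theorem averageMap_apply (hT : Continuous T) (f : C(X, ℝ)) (m : ℕ) (x : X) :
    averageMap hT f m x = birkhoffAverage ℝ T f m x := rfl

theorem integral_birkhoffAverage {ν : Measure X} [IsFiniteMeasure ν] (hT : Continuous T)
    (hν : MeasurePreserving T ν ν) (f : C(X, ℝ)) {m : ℕ} (hm : 0 < m) :
    ∫ x, averageMap hT f m x ∂ν = ∫ x, f x ∂ν := by
  have h : ∀ k, ∫ x, f (T^[k] x) ∂ν = ∫ x, f x ∂ν := fun k => by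
    have hk := hν.iterate k
    conv_rhs => rw [← hk.map_eq]
    rw [integral_map hk.measurable.aemeasurable f.continuous.aestronglyMeasurable]
  have hm' : (m : ℝ) ≠ 0 := by positivity
  simp only [averageMap_apply, birkhoffAverage, birkhoffSum, smul_eq_mul]
  have hint : ∀ i ∈ Finset.range m, Integrable (fun x => f (T^[i] x)) ν := fun i _ =>
    integrable_continuousMap ν (f.comp ⟨T^[i], hT.iterate i⟩)
  rw [integral_const_mul, integral_finsetSum _ hint]
  simp only [h, Finset.sum_const, Finset.card_range, nsmul_eq_mul]
  field_simp

theorem birkhoffAverage_iterate_of_periodic (f : X → ℝ) {q : X} {P : ℕ} (hq : T^[P] q = q)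
    (i : ℕ) : birkhoffAverage ℝ T f P (T^[i] q) = birkhoffAverage ℝ T f P q := by
  induction i with
  | zero => rfl
  | succ i ih =>
    rw [Function.iterate_succ_apply', ← ih, ← sub_eq_zero,
      birkhoffAverage_apply_sub_birkhoffAverage, ← Function.iterate_add_apply, add_comm P i,
      Function.iterate_add_apply, hq]
    simp

/-- The variance of the Birkhoff average of `f` of length `m`. -/
noncomputable def averageVariance (hT : Continuous T) (f : C(X, ℝ)) (m : ℕ)
    (μ : ProbabilityMeasure X) : ℝ :=
  integ μ (averageMap hT f m * averageMap hT f m) - integ μ f ^ 2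

/-- The average over a full period is constant along the periodic orbit. -/
theorem averageVariance_periodic (hT : Continuous T) (f : C(X, ℝ)) {q : X} {n : ℕ}
    (hq : T^[n + 1] q = q) : averageVariance hT f (n + 1) (empirical T q n) = 0 := by
  unfold averageVariance
  rw [integ_empirical, integ_empirical]
  have : birkhoffSum T (averageMap hT f (n + 1) * averageMap hT f (n + 1) : C(X, ℝ)) (n + 1) q =
      (n + 1) * birkhoffAverage ℝ T f (n + 1) q ^ 2 := by
    unfold birkhoffSum
    rw [Finset.sum_congr rfl fun i _ => show _ = birkhoffAverage ℝ T f (n + 1) q ^ 2 by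
      rw [ContinuousMap.mul_apply, averageMap_apply, birkhoffAverage_iterate_of_periodic f hq,
        pow_two]]
    simp
  rw [birkhoffAverage_eq_div, this]
  push_cast
  field_simp
  ring

/-- On an invariant set `f` and its Birkhoff averages have the same integral, and small variance
keeps these averages close to `∫ f` in mean. -/
theorem abs_setIntegral_sub_le (hT : Continuous T) {μ : ProbabilityMeasure X}
    (hμ : MeasurePreserving T (μ : Measure X) (μ : Measure X)) {s : Set X} (hs : MeasurableSet s)
    (hsT : T ⁻¹' s = s) (f : C(X, ℝ)) {m : ℕ} (hm : 0 < m) {η : ℝ} (hη : 0 < η)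
    (hv : averageVariance hT f m μ < η ^ 2) :
    |∫ x in s, f x ∂(μ : Measure X) - (μ : Measure X).real s * integ μ f| ≤ η := by
  set c := integ μ f with hc
  set A := averageMap hT f m
  have hν : MeasurePreserving T ((μ : Measure X).restrict s) ((μ : Measure X).restrict s) := by
    have := hμ.restrict_preimage hs
    rwa [hsT] at this
  have h1 := integral_birkhoffAverage hT hν f hm
  have h2 : integ μ A = c := integral_birkhoffAverage hT hμ f hm
  set D : C(X, ℝ) := A - ContinuousMap.const X c
  have hvar : integ μ (D * D) = averageVariance hT f m μ := by
    have e : D * D = (A * A - ContinuousMap.const X (2 * c) * A) + ContinuousMap.const X (c ^ 2) := by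
      ext x; simp [D]; ring
    have e1 : integ μ (ContinuousMap.const X (2 * c) * A) = 2 * c * integ μ A := by
      unfold integ
      simp [integral_const_mul]
    rw [e, integ_add, integ_const, integ_sub, e1, h2]
    unfold averageVariance
    ring
  have hdiff : ∫ x in s, f x ∂(μ : Measure X) - (μ : Measure X).real s * c =
      ∫ x in s, D x ∂(μ : Measure X) := by
    rw [← h1]
    have : ∫ x in s, D x ∂(μ : Measure X) =
        ∫ x in s, A x ∂(μ : Measure X) - ∫ x in s, c ∂(μ : Measure X) :=
      integral_sub (integrable_continuousMap _ A) (integrable_const c)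
    rw [this, setIntegral_const, smul_eq_mul]
  -- The arithmetic-geometric mean inequality stands in for Cauchy–Schwarz.
  have hbound : ∀ x, |D x| ≤ (2 * η)⁻¹ * (D * D) x + η / 2 := fun x => by
    have hsq : (D * D) x = |D x| ^ 2 := by rw [sq_abs, pow_two]; rfl
    rw [hsq]
    have : 0 ≤ (|D x| - η) ^ 2 := sq_nonneg _
    rw [← sub_nonneg]
    have e : (2 * η)⁻¹ * |D x| ^ 2 + η / 2 - |D x| = (2 * η)⁻¹ * (|D x| - η) ^ 2 := by
      field_simp; ring
    rw [e]
    positivity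
  have hDint : Integrable (fun x => |D x|) (μ : Measure X) :=
    (integrable_continuousMap (μ : Measure X) D).abs
  have hDDint : Integrable (fun x => (2 * η)⁻¹ * (D * D) x) (μ : Measure X) :=
    (integrable_continuousMap _ (D * D)).const_mul _
  rw [hdiff]
  calc |∫ x in s, D x ∂(μ : Measure X)| ≤ ∫ x in s, |D x| ∂(μ : Measure X) :=
        abs_integral_le_integral_abs
    _ ≤ ∫ x, |D x| ∂(μ : Measure X) :=
        setIntegral_le_integral hDint (ae_of_all _ fun x => abs_nonneg _)
    _ ≤ ∫ x, ((2 * η)⁻¹ * (D * D) x + η / 2) ∂(μ : Measure X) :=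
        integral_mono hDint (hDDint.add (integrable_const _)) hbound
    _ = (2 * η)⁻¹ * integ μ (D * D) + η / 2 := by
        rw [integral_add hDDint (integrable_const _), integral_const_mul]
        simp [integ]
    _ ≤ (2 * η)⁻¹ * η ^ 2 + η / 2 := by
        rw [hvar]
        have : 0 < (2 * η)⁻¹ := by positivity
        have := mul_le_mul_of_nonneg_left hv.le this.le
        linarith
    _ = η := by field_simp; norm_num

theorem continuous_integral_continuousMap (ν : Measure X) [IsFiniteMeasure ν] :
    Continuous fun f : C(X, ℝ) => ∫ x, f x ∂ν := by
  refine LipschitzWith.continuous (K := ⟨ν.real Set.univ, measureReal_nonneg⟩)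
    (LipschitzWith.of_dist_le_mul fun f g => ?_)
  rw [dist_eq_norm, ← integral_sub (integrable_continuousMap ν f) (integrable_continuousMap ν g),
    dist_eq_norm]
  refine (norm_integral_le_of_norm_le_const (C := ‖f - g‖)
    (ae_of_all _ fun x => (f - g).norm_coe_le_norm x)).trans ?_
  rw [mul_comm]
  rfl

/-- For an invariant `s`, arbitrarily small variances give `∫ f` over `s` equal to `μ s * ∫ f`,
first on a dense family and then for all `f`. Hence the restriction of `μ` to `s` is `μ s • μ`, and
evaluating at `s` gives `μ s = μ s ^ 2`. -/
theorem ergodic_of_averageVariance (hT : Continuous T) {μ : ProbabilityMeasure X}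
    (hμ : MeasurePreserving T (μ : Measure X) (μ : Measure X)) {ι : Type*} {f : ι → C(X, ℝ)}
    (hf : DenseRange f) (h : ∀ i (l : ℕ), ∃ m, 0 < m ∧
      averageVariance hT (f i) m μ < 1 / ((l : ℝ) + 1)) :
    Ergodic T (μ : Measure X) := by
  refine ⟨hμ, ⟨fun s hs hsT => ?_⟩⟩
  have hdense : ∀ i, ∫ x in s, f i x ∂(μ : Measure X) =
      (μ : Measure X).real s * integ μ (f i) := by
    intro i
    rw [← sub_eq_zero, ← abs_eq_zero]
    refine le_antisymm (le_of_forall_pos_le_add fun η hη => ?_) (abs_nonneg _)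
    obtain ⟨l, hl⟩ := exists_nat_one_div_lt (pow_pos hη 2)
    obtain ⟨m, hm, hv⟩ := h i l
    rw [zero_add]
    exact abs_setIntegral_sub_le hT hμ hs hsT (f i) hm hη (hv.trans hl)
  have hall : ∀ g : C(X, ℝ), ∫ x in s, g x ∂(μ : Measure X) =
      (μ : Measure X).real s * integ μ g := by
    intro g
    refine isClosed_property (p := fun g : C(X, ℝ) => ∫ x in s, g x ∂(μ : Measure X) =
      (μ : Measure X).real s * integ μ g) hf (isClosed_eq ?_ ?_) hdense g
    · exact continuous_integral_continuousMap _
    · exact continuous_const.mul (continuous_integral_continuousMap _)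
  have hmeas : (μ : Measure X).restrict s = (μ : Measure X) s • (μ : Measure X) := by
    have : IsFiniteMeasure ((μ : Measure X) s • (μ : Measure X)) :=
      Measure.smul_finite _ (measure_ne_top _ _)
    refine ext_of_forall_integral_eq_of_IsFiniteMeasure fun g => ?_
    rw [integral_smul_measure]
    exact hall g.toContinuousMap
  have heq : (μ : Measure X) s = (μ : Measure X) s * (μ : Measure X) s := by
    have := congrArg (fun ν : Measure X => ν s) hmeas
    simpa [Measure.restrict_apply hs] using this
  rw [eventuallyConst_set']
  rcases eq_or_ne ((μ : Measure X) s) 0 with h0 | h0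
  · exact Or.inl (ae_eq_empty.2 h0)
  · right
    have h1 : (μ : Measure X) s = 1 := by
      have := (ENNReal.mul_eq_left h0 (measure_ne_top _ _)).1 heq.symm
      exact this
    exact ae_eq_univ_iff_measure_eq hs.nullMeasurableSet |>.2 (by simp [h1])

theorem isRich_periodicClosure (hspec : BowenSpecification T) (hT : Continuous T) :
    IsRich T (periodicClosure T) where
  isClosed := isClosed_closure
  subset := subset_rfl
  mix_mem t _ _ hμ hν := mix_mem_periodicClosure hspec hT t hμ hν
  exists_charging y _ hr :=
    let ⟨ρ, hρ, h⟩ := exists_periodicMeasure_charging hspec y hr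
    ⟨ρ, periodicMeasures_subset_closure hρ, finitelySupported_of_mem_periodicMeasures hρ, h⟩

/-- Small variance at some length is an open condition and holds at all periodic measures, so it is
generic in their closure. -/
theorem exists_ergodic_full_support [Nonempty X] (hspec : BowenSpecification T)
    (hT : Continuous T) : ∃ μ ∈ periodicClosure T, μ ∈ ergodicMeasures T ∧
      ∀ y r, 0 < r → 0 < integ μ (bump y r) := by
  let f : ℕ → C(X, ℝ) := TopologicalSpace.denseSeq C(X, ℝ)
  let G : ℕ × ℕ → Set (ProbabilityMeasure X) := fun i =>
    ⋃ m : ℕ, {μ | 0 < m ∧ averageVariance hT (f i.1) m μ < 1 / ((i.2 : ℝ) + 1)}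
  obtain ⟨μ, hμ, hfull, hG⟩ :=
    (isRich_periodicClosure hspec hT).exists_full_support (G := G)
    (fun i => isOpen_iUnion fun m => by
      have hc : Continuous fun μ : ProbabilityMeasure X => averageVariance hT (f i.1) m μ :=
        (continuous_integ _).sub ((continuous_integ _).pow 2)
      by_cases hm : 0 < m
      · simpa [hm] using isOpen_lt hc continuous_const
      · simp [hm])
    (fun i => closure_mono fun μ hμ => by
      refine ⟨?_, periodicMeasures_subset_closure hμ⟩
      obtain ⟨q, n, hq, rfl⟩ := hμ
      refine Set.mem_iUnion.2 ⟨n + 1, Nat.succ_pos n, ?_⟩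
      rw [averageVariance_periodic hT _ hq]
      positivity)
  refine ⟨μ, hμ, ?_, hfull⟩
  refine ergodic_of_averageVariance hT (periodicClosure_subset_invariantMeasures hT hμ)
    (TopologicalSpace.denseRange_denseSeq C(X, ℝ)) fun i l => ?_
  exact Set.mem_iUnion.1 (hG (i, l))

end Ergodic

/-! ### Criteria for the recurrence classes -/

section Recurrence

variable {X : Type*} [MetricSpace X] [CompactSpace X] {T : X → X}

theorem birkhoffAverage_le_mul {f g : X → ℝ} {c : ℝ} (h : ∀ y, f y ≤ c * g y) (n : ℕ) (x : X) :
    birkhoffAverage ℝ T f n x ≤ c * birkhoffAverage ℝ T g n x := by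
  rw [birkhoffAverage_eq_div, birkhoffAverage_eq_div, ← mul_div_assoc]
  refine div_le_div_of_nonneg_right ?_ (Nat.cast_nonneg n)
  unfold birkhoffSum
  rw [Finset.mul_sum]
  exact Finset.sum_le_sum fun i _ => h _

theorem birkhoffAverage_nonneg {f : X → ℝ} (h : ∀ y, 0 ≤ f y) (n : ℕ) (x : X) :
    0 ≤ birkhoffAverage ℝ T f n x := by
  rw [birkhoffAverage_eq_div]
  exact div_nonneg (Finset.sum_nonneg fun i _ => h _) (Nat.cast_nonneg n)

theorem birkhoffAverage_const {n : ℕ} (hn : 0 < n) (c : ℝ) (x : X) :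
    birkhoffAverage ℝ T (fun _ => c) n x = c := by
  have : (n : ℝ) ≠ 0 := by positivity
  rw [birkhoffAverage_eq_div]
  simp only [birkhoffSum, Finset.sum_const, Finset.card_range, nsmul_eq_mul]
  field_simp

theorem visitFreq_nonneg (x : X) (E : Set X) (n : ℕ) : 0 ≤ visitFreq T x E n :=
  birkhoffAverage_nonneg (fun y => Set.indicator_nonneg (fun _ _ => zero_le_one) y) n x

theorem visitFreq_le_one (x : X) (E : Set X) (n : ℕ) : visitFreq T x E n ≤ 1 := by
  rcases Nat.eq_zero_or_pos n with rfl | hn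
  · simp [visitFreq]
  · have := birkhoffAverage_le_mul (T := T) (f := E.indicator fun _ => (1 : ℝ))
      (g := fun _ => (1 : ℝ)) (c := 1)
      (fun y => by rw [mul_one]; exact Set.indicator_le_self' (fun _ _ => zero_le_one) y) n x
    rwa [birkhoffAverage_const hn, mul_one] at this

theorem isBoundedUnder_le_visitFreq (x : X) (E : Set X) :
    IsBoundedUnder (· ≤ ·) atTop (visitFreq T x E) :=
  isBoundedUnder_of ⟨1, visitFreq_le_one x E⟩

theorem isBoundedUnder_ge_visitFreq (x : X) (E : Set X) :
    IsBoundedUnder (· ≥ ·) atTop (visitFreq T x E) :=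
  isBoundedUnder_of ⟨0, visitFreq_nonneg x E⟩

theorem birkhoffAverage_bump_le (x y : X) {r : ℝ} (hr : 0 ≤ r) (n : ℕ) :
    birkhoffAverage ℝ T (bump y r) n x ≤ r * visitFreq T x (Metric.ball y r) n := by
  refine birkhoffAverage_le_mul (fun z => ?_) n x
  by_cases hz : z ∈ Metric.ball y r
  · rw [Set.indicator_of_mem hz, mul_one]
    exact bump_le hr z
  · rw [Set.indicator_of_notMem hz, mul_zero]
    exact (bump_eq_zero (by simpa using hz)).le

theorem visitFreq_half_ball_le (x y : X) {r : ℝ} (hr : 0 < r) (n : ℕ) :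
    visitFreq T x (Metric.ball y (r / 2)) n ≤ 2 / r * birkhoffAverage ℝ T (bump y r) n x := by
  refine birkhoffAverage_le_mul (fun z => ?_) n x
  by_cases hz : z ∈ Metric.ball y (r / 2)
  · rw [Set.indicator_of_mem hz]
    have h1 : r / 2 ≤ bump y r z :=
      le_max_of_le_right (by have := Metric.mem_ball.1 hz; linarith)
    have h2 := mul_le_mul_of_nonneg_left h1 (by positivity : 0 ≤ 2 / r)
    have h3 : 2 / r * (r / 2) = 1 := by field_simp
    linarith
  · rw [Set.indicator_of_notMem hz]
    exact mul_nonneg (by positivity) (bump_nonneg _ _ _)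

/-- Every open set is visited by the orbit of `x` with positive upper frequency. -/
def IsFullyRecurrent (T : X → X) (x : X) : Prop :=
  ∀ y r, 0 < r → ¬ Tendsto (fun n => birkhoffAverage ℝ T (bump y r) n x) atTop (𝓝 0)

theorem IsFullyRecurrent.mem_quasiWeaklyAlmostPeriodic {x : X} (h : IsFullyRecurrent T x) :
    x ∈ quasiWeaklyAlmostPeriodic T := by
  intro ε hε
  by_contra hcon
  refine h x ε hε ?_
  have hlim : Tendsto (visitFreq T x (Metric.ball x ε)) atTop (𝓝 0) :=
    tendsto_of_le_liminf_of_limsup_le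
      (le_liminf_of_le (isBoundedUnder_le_visitFreq x _).isCoboundedUnder_ge
        (Eventually.of_forall (visitFreq_nonneg x _))) (not_lt.1 hcon)
      (isBoundedUnder_le_visitFreq x _) (isBoundedUnder_ge_visitFreq x _)
  exact squeeze_zero (fun n => birkhoffAverage_nonneg (bump_nonneg _ _) n x)
    (birkhoffAverage_bump_le x x hε.le) (by simpa using hlim.const_mul ε)

/-- A center missing `y` misses a ball around it, so the orbit would visit the ball of half that
radius with frequency zero. -/
theorem IsFullyRecurrent.center_eq_univ {x : X} (h : IsFullyRecurrent T x) {E : Set X}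
    (hE : IsCenterOfAttraction T {x} E) : E = Set.univ := by
  refine Set.eq_univ_of_forall fun y => ?_
  by_contra hy
  obtain ⟨r, hr, hrE⟩ := Metric.isOpen_iff.1 hE.1.isOpen_compl y hy
  refine h y (r / 2) (half_pos hr) ?_
  have hfreq := hE.2.2 x rfl (r / 2) (half_pos hr)
  have hle : ∀ᶠ n in atTop, birkhoffAverage ℝ T (bump y (r / 2)) n x ≤
      r / 2 * (1 - visitFreq T x (Metric.thickening (r / 2) E) n) := by
    filter_upwards [eventually_gt_atTop 0] with n hn
    have e : 1 - visitFreq T x (Metric.thickening (r / 2) E) n = birkhoffAverage ℝ T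
        ((fun _ => 1) - (Metric.thickening (r / 2) E).indicator fun _ => (1 : ℝ)) n x := by
      rw [birkhoffAverage_sub, Pi.sub_apply, Pi.sub_apply, birkhoffAverage_const hn]
      rfl
    rw [e]
    refine birkhoffAverage_le_mul (fun z => ?_) n x
    rw [Pi.sub_apply]
    by_cases hz : z ∈ Metric.thickening (r / 2) E
    · rw [Set.indicator_of_mem hz, sub_self, mul_zero]
      obtain ⟨w, hw, hd⟩ := Metric.mem_thickening_iff.1 hz
      refine (bump_eq_zero ?_).le
      by_contra hlt
      refine hrE (?_ : w ∈ Metric.ball y r) hw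
      have := dist_triangle_left w y z
      rw [Metric.mem_ball]
      linarith
    · rw [Set.indicator_of_notMem hz, sub_zero, mul_one]
      exact bump_le (half_pos hr).le z
  refine squeeze_zero' (Eventually.of_forall fun n =>
    birkhoffAverage_nonneg (bump_nonneg _ _) n x) hle ?_
  simpa using (hfreq.const_sub 1).const_mul (r / 2)

theorem isCenterOfAttraction_univ (x : X) : IsCenterOfAttraction T {x} Set.univ := by
  refine ⟨isClosed_univ, Set.mapsTo_univ _ _, ?_⟩
  rintro y rfl ε hε
  refine tendsto_const_nhds.congr' ?_
  filter_upwards [eventually_gt_atTop 0] with n hn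
  have : Metric.thickening ε (Set.univ : Set X) = Set.univ :=
    Set.eq_univ_of_univ_subset (Metric.self_subset_thickening hε _)
  rw [this, visitFreq, Set.indicator_univ, birkhoffAverage_const hn]

theorem notMem_weaklyAlmostPeriodic {x : X} {ε : ℝ} (hε : 0 < ε) {s : ℕ → ℕ} (hs : StrictMono s)
    (h : Tendsto (fun j => birkhoffAverage ℝ T (bump x ε) (s j) x) atTop (𝓝 0)) :
    x ∉ weaklyAlmostPeriodic T := by
  intro hx
  obtain ⟨c, hc0, hc⟩ := exists_between (hx (ε / 2) (half_pos hε))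
  have hev := hs.tendsto_atTop.eventually
    (eventually_lt_of_lt_liminf hc (isBoundedUnder_ge_visitFreq x _))
  have h2 : Tendsto (fun j => 2 / ε * birkhoffAverage ℝ T (bump x ε) (s j) x) atTop (𝓝 0) := by
    simpa using h.const_mul (2 / ε)
  obtain ⟨j, h3, h4⟩ := (hev.and (h2.eventually (gt_mem_nhds hc0))).exists
  have := visitFreq_half_ball_le (T := T) x x hε (s j)
  linarith

theorem notMem_quasiWeaklyAlmostPeriodic {x : X} {ε : ℝ} (hε : 0 < ε)
    (h : Tendsto (fun n => birkhoffAverage ℝ T (bump x ε) n x) atTop (𝓝 0)) :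
    x ∉ quasiWeaklyAlmostPeriodic T := by
  intro hx
  have hlim : Tendsto (visitFreq T x (Metric.ball x (ε / 2))) atTop (𝓝 0) :=
    squeeze_zero (visitFreq_nonneg x _) (visitFreq_half_ball_le x x hε)
      (by simpa using h.const_mul (2 / ε))
  have := hx (ε / 2) (half_pos hε)
  rw [hlim.limsup_eq] at this
  exact lt_irrefl _ this

theorem mem_weaklyAlmostPeriodic {x : X}
    (h : ∀ ε : ℝ, 0 < ε → ∃ c > 0, ∀ᶠ n in atTop, c ≤ birkhoffAverage ℝ T (bump x ε) n x) :
    x ∈ weaklyAlmostPeriodic T := by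
  intro ε hε
  obtain ⟨c, hc, hev⟩ := h ε hε
  refine (div_pos hc hε).trans_le (le_liminf_of_le
    (isBoundedUnder_le_visitFreq x _).isCoboundedUnder_ge ?_)
  filter_upwards [hev] with n hn
  rw [div_le_iff₀ hε, mul_comm]
  exact hn.trans (birkhoffAverage_bump_le x x hε.le n)

/-- Whenever the orbit comes very close to the invariant set `F`, it stays near `F` for an
arbitrarily long stretch and so away from `x`; return times to a neighbourhood of `x` then have
unbounded gaps. -/
theorem notMem_almostPeriodic (hT : Continuous T) {F : Set X} (hF : IsClosed F)
    (hFne : F.Nonempty) (hFT : Set.MapsTo T F F) {x : X} (hx : x ∉ F)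
    (h : ∀ O, IsOpen O → F ⊆ O → ∃ n, T^[n] x ∈ O) : x ∉ almostPeriodic T := by
  intro hA
  have hd : 0 < Metric.infDist x F := (hF.notMem_iff_infDist_pos hFne).1 hx
  set δ := Metric.infDist x F / 2 with hδ
  obtain ⟨N, -, hN⟩ := hA (Metric.cthickening δ F)ᶜ Metric.isClosed_cthickening.isOpen_compl
    (fun hmem => by
      rw [(hF.isCompact).cthickening_eq_biUnion_closedBall (half_pos hd).le] at hmem
      obtain ⟨y, hy, hxy⟩ := Set.mem_iUnion₂.1 hmem
      have h1 := Metric.infDist_le_dist_of_mem (x := x) hy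
      have h2 := Metric.mem_closedBall.1 hxy
      linarith)
  -- Points of `O` stay near `F` for times `0` to `N`. Removing `x` excludes time zero, since almost
  -- periodicity only concerns `n ≥ 1`.
  set O : Set X := (⋂ k ∈ Finset.range (N + 1), T^[k] ⁻¹' Metric.thickening δ F) \ {x}
  have hO : IsOpen O := by
    refine IsOpen.sdiff ?_ isClosed_singleton
    exact isOpen_biInter_finset fun k _ => Metric.isOpen_thickening.preimage (hT.iterate k)
  have hFO : F ⊆ O := by
    intro y hy
    refine ⟨Set.mem_iInter₂.2 fun k _ => ?_, ?_⟩
    · exact Metric.self_subset_thickening (half_pos hd) _ (hFT.iterate k hy)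
    · rintro rfl
      exact hx hy
  obtain ⟨n, hn⟩ := h O hO hFO
  have hn1 : 1 ≤ n := by
    by_contra h0
    have : n = 0 := by omega
    subst this
    exact hn.2 rfl
  obtain ⟨k, hk, hkU⟩ := hN n hn1
  obtain ⟨j, rfl⟩ := Nat.exists_eq_add_of_le hk.1
  have hj : j ∈ Finset.range (N + 1) := Finset.mem_range.2 (by have := hk.2; omega)
  have := Set.mem_iInter₂.1 hn.1 j hj
  rw [Set.mem_preimage, ← Function.iterate_add_apply, add_comm] at this
  exact hkU (Metric.thickening_subset_cthickening _ _ this)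

theorem exists_iterate_mem_ball {x y : X} {r L : ℝ} (hL : 0 < L)
    (h : Tendsto (fun n => birkhoffAverage ℝ T (bump y r) n x) atTop (𝓝 L)) :
    ∃ n, T^[n] x ∈ Metric.ball y r := by
  by_contra! hcon
  have h0 : ∀ n, birkhoffAverage ℝ T (bump y r) n x = 0 := fun n => by
    rw [birkhoffAverage_eq_div, birkhoffSum, Finset.sum_eq_zero, zero_div]
    intro i _
    exact bump_eq_zero (by simpa using hcon i)
  simp only [h0] at h
  exact hL.ne (tendsto_nhds_unique tendsto_const_nhds h)

end Recurrence

/-! ### Consequences of gluing for averages, limit measures and supports -/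

section Glued

variable {X : Type*} [MetricSpace X] [CompactSpace X] [MeasurableSpace X] [BorelSpace X]
  {T : X → X} {κ : ℕ → ProbabilityMeasure X} {x : X}

theorem IsGlued.tendsto (h : IsGlued T κ x) {f : C(X, ℝ)} {a : ℝ} (ha : ∀ m, integ (κ m) f = a) :
    Tendsto (fun n => birkhoffAverage ℝ T f n x) atTop (𝓝 a) := by
  obtain ⟨-, i, i', θ, h⟩ := h
  refine tendsto_sub_nhds_zero_iff.1 ((h f).congr fun n => ?_)
  rw [integ_mix, ha, ha]
  ring

theorem IsGlued.eventually_ge (h : IsGlued T κ x) {f : C(X, ℝ)} {c : ℝ} (hc : 0 < c)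
    (hκ : ∀ m, c ≤ integ (κ m) f) : ∀ᶠ n in atTop, c / 2 ≤ birkhoffAverage ℝ T f n x := by
  obtain ⟨-, i, i', θ, h⟩ := h
  filter_upwards [(h f).eventually (lt_mem_nhds (show -(c / 2) < 0 by linarith))] with n hn
  rw [integ_mix] at hn
  have h1 := mul_le_mul_of_nonneg_left (hκ (i n)) (sub_nonneg.2 (θ n).2.2)
  have h2 := mul_le_mul_of_nonneg_left (hκ (i' n)) (θ n).2.1
  linarith

theorem IsGlued.eq_of_tendsto (h : IsGlued T κ x) {f : C(X, ℝ)} {L : ℝ}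
    (hL : Tendsto (fun n => birkhoffAverage ℝ T f n x) atTop (𝓝 L)) (m : ℕ) :
    integ (κ m) f = L := by
  obtain ⟨s, hs, hlim⟩ := h.1 m
  exact tendsto_nhds_unique (hlim f) (hL.comp hs.tendsto_atTop)

theorem IsGlued.mem_phiIrregular (h : IsGlued T κ x) {f : C(X, ℝ)} {m m' : ℕ}
    (hne : integ (κ m) f ≠ integ (κ m') f) : x ∈ phiIrregular T f := by
  rintro ⟨L, hL⟩
  exact hne ((h.eq_of_tendsto hL m).trans (h.eq_of_tendsto hL m').symm)

theorem quasiregular_subset_phiRegular (f : C(X, ℝ)) : quasiregular T ⊆ phiRegular T f := by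
  intro x hx
  obtain ⟨μ, -, hμ⟩ := Set.mem_iUnion₂.1 hx
  exact ⟨_, hμ f⟩

theorem IsGlued.isFullyRecurrent (h : IsGlued T κ x)
    (hκ : ∀ y r, 0 < r → ∃ m, 0 < integ (κ m) (bump y r)) : IsFullyRecurrent T x := by
  intro y r hr hlim
  obtain ⟨m, hm⟩ := hκ y r hr
  exact hm.ne' (h.eq_of_tendsto hlim m)

theorem IsGlued.mem_limitMeasures (h : IsGlued T κ x) (m : ℕ) : κ m ∈ limitMeasures T x := by
  obtain ⟨s, hs, hlim⟩ := h.1 m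
  -- `empirical T x n` averages `n + 1` points, so times are lowered by one and the sequence is
  -- shifted to keep them positive.
  have hpos : ∀ j, 1 ≤ s (j + 1) := fun j => (Nat.succ_le_succ (Nat.zero_le j)).trans hs.le_apply
  refine ⟨fun j => s (j + 1) - 1, fun a b hab => ?_, tendsto_iff_integ.2 fun f => ?_⟩
  · have := hs (Nat.succ_lt_succ hab)
    have := hpos a
    simp only [Nat.succ_eq_add_one] at *
    omega
  · simp only [integ_empirical, Nat.sub_add_cancel (hpos _)]
    exact (hlim f).comp (tendsto_add_atTop_nat 1)

theorem IsGlued.mem_V (h : IsGlued T κ x) {m : ℕ}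
    (hm : ∀ y r, 0 < r → 0 < integ (κ m) (bump y r)) : x ∈ V T := by
  have hrec := h.isFullyRecurrent fun y r hr => ⟨m, hm y r hr⟩
  refine ⟨hrec.mem_quasiWeaklyAlmostPeriodic, Set.univ,
    ⟨isCenterOfAttraction_univ x, fun E hE _ => (hrec.center_eq_univ hE).ge⟩, κ m,
    h.mem_limitMeasures m, support_eq_univ_of_integ_bump_pos hm⟩

/-- Along an ultrafilter the weights and both components of the mixtures converge, the components
inside `K`; so each limit measure is a mixture of two members of `K`. -/
theorem IsGlued.finitelySupported_of_mem_limitMeasures (h : IsGlued T κ x)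
    {K : Set (ProbabilityMeasure X)} (hK : IsCompact K) (hκ : ∀ m, κ m ∈ K)
    (hfin : ∀ α ∈ K, FinitelySupported T α) {μ : ProbabilityMeasure X}
    (hμ : μ ∈ limitMeasures T x) : FinitelySupported T μ := by
  obtain ⟨-, i, i', θ, h⟩ := h
  obtain ⟨s, hs, hlim⟩ := hμ
  let u : Ultrafilter ℕ := Ultrafilter.of atTop
  have hu : (u : Filter ℕ) ≤ atTop := Ultrafilter.of_le _
  let g : ℕ → unitInterval × ProbabilityMeasure X × ProbabilityMeasure X := fun n =>
    (θ (s n + 1), κ (i (s n + 1)), κ (i' (s n + 1)))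
  obtain ⟨p, hp, hup⟩ := (isCompact_univ.prod (hK.prod hK)).ultrafilter_le_nhds (u.map g)
    (le_principal_iff.2 (Ultrafilter.mem_map.2
      (Eventually.of_forall fun n => ⟨trivial, hκ (i (s n + 1)), hκ (i' (s n + 1))⟩)))
  have hg : Tendsto g u (𝓝 p) := hup
  have hmix := (continuous_mix.tendsto p).comp hg
  have hs1 : Tendsto (fun n => s n + 1) atTop atTop :=
    (tendsto_add_atTop_nat 1).comp hs.tendsto_atTop
  have heq : μ = mix p.1 p.2.1 p.2.2 := by
    refine ext_of_integ fun f => ?_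
    have h1 := ((tendsto_iff_integ.1 hlim f).mono_left hu)
    have h2 := (((h f).comp hs1).mono_left hu)
    have h3 := h1.sub h2
    rw [sub_zero] at h3
    refine tendsto_nhds_unique h3 ((tendsto_iff_integ.1 hmix f).congr fun n => ?_)
    simp only [Function.comp_apply, integ_empirical, g]
    ring
  rw [heq]
  exact (hfin _ hp.2.1).mix (hfin _ hp.2.2) _

theorem FinitelySupported.support_ne_univ [Infinite X] {μ : ProbabilityMeasure X}
    (h : FinitelySupported T μ) : (μ : Measure X).support ≠ Set.univ := by
  obtain ⟨F, hF, -, -, hμ⟩ := h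
  intro hsupp
  obtain ⟨y, hy⟩ := hF.exists_notMem
  have hy' : y ∈ (μ : Measure X).support := hsupp ▸ Set.mem_univ y
  exact ((Measure.mem_support_iff_forall y).1 hy' _ (hF.isClosed.isOpen_compl.mem_nhds hy)).ne'
    hμ

end Glued

/-! ### Witnesses for each gap -/

section Gaps

variable {X : Type*} [MetricSpace X] [CompactSpace X] [Infinite X] [MeasurableSpace X]
  [BorelSpace X] {T : X → X} {𝒞 : Set (ProbabilityMeasure X)} {U : Set X}

/-- A generic point of a fully supported ergodic measure approaches every periodic orbit; chosen off
one of them, it cannot be almost periodic. -/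
theorem exists_regular_diff_almostPeriodic (hspec : BowenSpecification T) (hT : Continuous T)
    (hU : IsOpen U) (hne : U.Nonempty) : ∃ x ∈ U, x ∈ regular T \ almostPeriodic T := by
  obtain ⟨μ, hμ, herg, hfull⟩ := exists_ergodic_full_support hspec hT
  obtain ⟨q, n, hq, -⟩ := hspec.dense_periodic (Classical.arbitrary X) one_pos
  have hfin := finite_orbit_of_periodic hq
  obtain ⟨x, ⟨hxU, hxF⟩, hx⟩ := exists_isGlued hspec hT (hU.sdiff hfin.isClosed)
    (hspec.diff_finite_nonempty hT hU hne hfin) (κ := fun _ => μ) fun _ => hμ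
  have hgen : ∀ f : C(X, ℝ), Tendsto (fun n => birkhoffAverage ℝ T f n x) atTop
      (𝓝 (integ μ f)) := fun f => hx.tendsto fun _ => rfl
  refine ⟨x, hxU, Set.mem_iUnion₂.2 ⟨μ, herg, hgen, ?_⟩, ?_⟩
  · rw [support_eq_univ_of_integ_bump_pos hfull]
    trivial
  · refine notMem_almostPeriodic hT hfin.isClosed ⟨_, ⟨0, rfl⟩⟩ ?_ hxF fun O hO hFO => ?_
    · rintro _ ⟨i, rfl⟩
      exact ⟨i + 1, Function.iterate_succ_apply' T i q⟩
    · obtain ⟨r, hr, hrO⟩ := Metric.isOpen_iff.1 hO q (hFO ⟨0, rfl⟩)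
      obtain ⟨i, hi⟩ := exists_iterate_mem_ball (hfull q r hr) (hgen _)
      exact ⟨i, hrO hi⟩

theorem exists_bump_integ_eq_zero {ν : ProbabilityMeasure X} {F : Set X} (hF : F.Finite)
    (hν : (ν : Measure X) Fᶜ = 0) {x : X} (hx : x ∉ F) : ∃ r > 0, integ ν (bump x r) = 0 := by
  obtain ⟨r, hr, hrF⟩ := Metric.isOpen_iff.1 hF.isClosed.isOpen_compl x hx
  refine ⟨r, hr, integ_eq_zero_of_eqOn hν fun z hz => bump_eq_zero ?_⟩
  by_contra h
  exact hrF (not_le.1 h) hz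

/-- The point is generic for a finitely supported `ν` but lies off its carrier `F`. Its orbit
approaches `F`, so it is not almost periodic; and `ν` vanishes near it, so it is not in the support
of the measure it generates. -/
theorem IsRich.exists_quasiregular_diff (hspec : BowenSpecification T) (hT : Continuous T)
    (h𝒞 : IsRich T 𝒞) (hU : IsOpen U) (hne : U.Nonempty) :
    ∃ x ∈ U, x ∈ quasiregular T \ (almostPeriodic T ∪ regular T) ∧
      ∀ φ a, (∀ μ ∈ 𝒞, integ μ φ = a) → x ∈ phiLevel T φ a := by
  obtain ⟨ν, hν, ⟨F, hF, hFne, hFT, hνF⟩, -⟩ :=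
    h𝒞.exists_charging (Classical.arbitrary X) 1 one_pos
  obtain ⟨x, ⟨hxU, hxF⟩, hx⟩ := exists_isGlued hspec hT (hU.sdiff hF.isClosed)
    (hspec.diff_finite_nonempty hT hU hne hF) (κ := fun _ => ν) fun _ => h𝒞.subset hν
  have hgen : ∀ f : C(X, ℝ), Tendsto (fun n => birkhoffAverage ℝ T f n x) atTop
      (𝓝 (integ ν f)) := fun f => hx.tendsto fun _ => rfl
  refine ⟨x, hxU, ⟨Set.mem_iUnion₂.2
    ⟨ν, periodicClosure_subset_invariantMeasures hT (h𝒞.subset hν), hgen⟩, ?_⟩,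
    fun φ a h => hx.tendsto fun _ => h ν hν⟩
  rintro (hA | hR)
  · refine notMem_almostPeriodic hT hF.isClosed hFne hFT hxF (fun O hO hFO => ?_) hA
    obtain ⟨y, hyF, hy⟩ : ∃ y ∈ F, (ν : Measure X) {y} ≠ 0 := by
      by_contra! hcon
      have h1 : (ν : Measure X) F = 0 := by
        rw [← Set.biUnion_of_singleton F]
        exact (measure_biUnion_null_iff hF.countable).2 hcon
      have h2 : (ν : Measure X) Set.univ = 0 := by
        rw [← Set.union_compl_self F]
        exact measure_union_null h1 hνF
      simp at h2
    obtain ⟨r, hr, hrO⟩ := Metric.isOpen_iff.1 hO y (hFO hyF)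
    have hpos : 0 < integ ν (bump y r) := integ_bump_pos ((pos_iff_ne_zero.2 hy).trans_le
      (measure_mono (Set.singleton_subset_iff.2 (Metric.mem_ball_self hr))))
    obtain ⟨i, hi⟩ := exists_iterate_mem_ball hpos (hgen _)
    exact ⟨i, hrO hi⟩
  · obtain ⟨μ, -, hμ, hsupp⟩ := Set.mem_iUnion₂.1 hR
    obtain ⟨r, hr, h0⟩ := exists_bump_integ_eq_zero hF hνF hxF
    have h1 : integ μ (bump x r) = integ ν (bump x r) := tendsto_nhds_unique (hμ _) (hgen _)
    have h2 := integ_bump_pos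
      ((Measure.mem_support_iff_forall x).1 hsupp _ (Metric.ball_mem_nhds x hr))
    linarith

/-- Two finitely supported members of `𝒞` with different integrals for `ψ`. -/
structure Separates (T : X → X) (𝒞 : Set (ProbabilityMeasure X)) (ψ : C(X, ℝ))
    (ν₀ ν₁ : ProbabilityMeasure X) : Prop where
  mem₀ : ν₀ ∈ 𝒞
  mem₁ : ν₁ ∈ 𝒞
  fin₀ : FinitelySupported T ν₀
  fin₁ : FinitelySupported T ν₁
  integ_ne : integ ν₀ ψ ≠ integ ν₁ ψ

theorem IsRich.exists_separates (h𝒞 : IsRich T 𝒞) : ∃ ψ ν₀ ν₁, Separates T 𝒞 ψ ν₀ ν₁ := by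
  obtain ⟨ν₀, h₀, hfin, -⟩ := h𝒞.exists_charging (Classical.arbitrary X) 1 one_pos
  obtain ⟨F, hF, -, -, hνF⟩ := id hfin
  obtain ⟨y, hy⟩ := hF.exists_notMem
  obtain ⟨r, hr, h0⟩ := exists_bump_integ_eq_zero hF hνF hy
  obtain ⟨ν₁, h₁, hfin₁, hpos⟩ := h𝒞.exists_charging y r hr
  exact ⟨bump y r, ν₀, ν₁, h₀, h₁, hfin, hfin₁, by rw [h0]; exact hpos.ne⟩

variable {ψ : C(X, ℝ)} {ν₀ ν₁ : ProbabilityMeasure X}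

theorem Separates.exists_ne (hs : Separates T 𝒞 ψ ν₀ ν₁) (μ : ProbabilityMeasure X) :
    ∃ ν ∈ 𝒞, FinitelySupported T ν ∧ integ ν ψ ≠ integ μ ψ := by
  by_cases h : integ ν₀ ψ = integ μ ψ
  · exact ⟨ν₁, hs.mem₁, hs.fin₁, fun h' => hs.integ_ne (h.trans h'.symm)⟩
  · exact ⟨ν₀, hs.mem₀, hs.fin₀, h⟩

theorem IsRich.exists_full (h𝒞 : IsRich T 𝒞) :
    ∃ η ∈ 𝒞, ∀ y r, 0 < r → 0 < integ η (bump y r) := by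
  obtain ⟨η, hη, hfull, -⟩ := h𝒞.exists_full_support (ι := Empty) (G := fun _ => Set.univ)
    (fun _ => isOpen_univ) (fun i => i.elim)
  exact ⟨η, hη, hfull⟩

/-- The sequence `μ, ν, ν, ν, …`. -/
def pairSeq (μ ν : ProbabilityMeasure X) : ℕ → ProbabilityMeasure X
  | 0 => μ
  | _ + 1 => ν

theorem pairSeq_forall {p : ProbabilityMeasure X → Prop} {μ ν : ProbabilityMeasure X} (hμ : p μ)
    (hν : p ν) : ∀ m, p (pairSeq μ ν m)
  | 0 => hμ
  | _ + 1 => hν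

/-- Oscillation between `η` and `(η + ν) / 2` destroys convergence for `ψ`, while both measures
dominate `η / 2`, bounding visit frequencies to each ball below. -/
theorem IsRich.exists_weaklyAlmostPeriodic_diff (hspec : BowenSpecification T)
    (hT : Continuous T) (h𝒞 : IsRich T 𝒞) (hs : Separates T 𝒞 ψ ν₀ ν₁) (hU : IsOpen U)
    (hne : U.Nonempty) : ∃ x ∈ U, x ∈ weaklyAlmostPeriodic T \ quasiregular T ∧
      x ∈ phiIrregular T ψ ∧ ∀ φ a, (∀ μ ∈ 𝒞, integ μ φ = a) → x ∈ phiLevel T φ a := by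
  obtain ⟨η, hη, hfull⟩ := h𝒞.exists_full
  obtain ⟨ν, hν, -, hνη⟩ := hs.exists_ne η
  -- `harmonicWeight 1` is `1 / 2`.
  set η' := mix (harmonicWeight 1) η ν with hη'
  have hmem : η' ∈ 𝒞 := h𝒞.mix_mem _ hη hν
  have hval : ∀ f, integ η' f = (integ η f + integ ν f) / 2 := fun f => by
    rw [hη', integ_mix, harmonicWeight]
    norm_num
    ring
  have hκ := pairSeq_forall (p := (· ∈ 𝒞)) hη hmem
  obtain ⟨x, hxU, hx⟩ := exists_isGlued hspec hT hU hne fun m => h𝒞.subset (hκ m)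
  have hirr : x ∈ phiIrregular T ψ := hx.mem_phiIrregular (m := 0) (m' := 1) (by
    change integ η ψ ≠ integ η' ψ
    rw [hval]
    intro h
    exact hνη (by linarith))
  refine ⟨x, hxU, ⟨mem_weaklyAlmostPeriodic fun ε hε => ?_,
    fun h => hirr (quasiregular_subset_phiRegular ψ h)⟩, hirr,
    fun φ a h => hx.tendsto fun m => h _ (hκ m)⟩
  have h1 := hfull x ε hε
  have h2 := integ_nonneg ν (bump_nonneg x ε)
  refine ⟨integ η (bump x ε) / 2 / 2, by positivity, hx.eventually_ge (by positivity) ?_⟩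
  refine pairSeq_forall (p := fun μ => integ η (bump x ε) / 2 ≤ integ μ (bump x ε))
    (by linarith) ?_
  rw [hval]
  linarith

/-- The limit measure `η` has full support, whereas along the times tracking `ν` the orbit almost
never visits a neighbourhood of `x`, chosen off the carrier of `ν`. -/
theorem IsRich.exists_V_diff (hspec : BowenSpecification T)
    (hT : Continuous T) (h𝒞 : IsRich T 𝒞) (hs : Separates T 𝒞 ψ ν₀ ν₁) (hU : IsOpen U)
    (hne : U.Nonempty) : ∃ x ∈ U, x ∈ V T \ weaklyAlmostPeriodic T ∧
      x ∈ phiIrregular T ψ ∧ ∀ φ a, (∀ μ ∈ 𝒞, integ μ φ = a) → x ∈ phiLevel T φ a := by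
  obtain ⟨η, hη, hfull⟩ := h𝒞.exists_full
  obtain ⟨ν, hν, ⟨F, hF, -, -, hνF⟩, hνη⟩ := hs.exists_ne η
  have hκ := pairSeq_forall (p := (· ∈ 𝒞)) hη hν
  obtain ⟨x, ⟨hxU, hxF⟩, hx⟩ := exists_isGlued hspec hT (hU.sdiff hF.isClosed)
    (hspec.diff_finite_nonempty hT hU hne hF) fun m => h𝒞.subset (hκ m)
  refine ⟨x, hxU, ⟨hx.mem_V (m := 0) hfull, ?_⟩, hx.mem_phiIrregular (m := 1) (m' := 0) hνη,
    fun φ a h => hx.tendsto fun m => h _ (hκ m)⟩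
  obtain ⟨r, hr, h0⟩ := exists_bump_integ_eq_zero hF hνF hxF
  obtain ⟨s, hsm, hlim⟩ := hx.1 1
  have := hlim (bump x r)
  rw [show integ (pairSeq η ν 1) (bump x r) = 0 from h0] at this
  exact notMem_weaklyAlmostPeriodic hr hsm this

/-- The `κ m` together charge every ball, so the minimal center is `X`. But they are finitely
supported and converge to the finitely supported `ν₀`, so every limit measure is finitely supported
and cannot have support `X`. -/
theorem IsRich.exists_quasiWeaklyAlmostPeriodic_diff (hspec : BowenSpecification T)
    (hT : Continuous T) (h𝒞 : IsRich T 𝒞) (hs : Separates T 𝒞 ψ ν₀ ν₁) (hU : IsOpen U)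
    (hne : U.Nonempty) : ∃ x ∈ U, x ∈ quasiWeaklyAlmostPeriodic T \ V T ∧
      x ∈ phiIrregular T ψ ∧ ∀ φ a, (∀ μ ∈ 𝒞, integ μ φ = a) → x ∈ phiLevel T φ a := by
  obtain ⟨c, r, hr, hcr⟩ := exists_countable_bumps X
  choose ρ hρ hρfin hρpos using fun i => h𝒞.exists_charging (c i) (r i) (hr i)
  -- As `harmonicWeight 0` is `1`, prepending `ν₁` makes `κ 0` equal to `ν₁`, whose `ψ`-integral
  -- differs from that of the limit `ν₀`.
  let ρ' : ℕ → ProbabilityMeasure X := fun m => Nat.casesOn m ν₁ ρ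
  have hρ' : ∀ m, ρ' m ∈ 𝒞 := fun m => by cases m; exacts [hs.mem₁, hρ _]
  have hρ'fin : ∀ m, FinitelySupported T (ρ' m) := fun m => by
    cases m; exacts [hs.fin₁, hρfin _]
  set κ : ℕ → ProbabilityMeasure X := fun m => mix (harmonicWeight m) ν₀ (ρ' m) with hκdef
  have hκ : ∀ m, κ m ∈ 𝒞 := fun m => h𝒞.mix_mem _ hs.mem₀ (hρ' m)
  have hlim : Tendsto κ atTop (𝓝 ν₀) := tendsto_mix_zero ν₀ ρ' tendsto_harmonicWeight
  obtain ⟨x, hxU, hx⟩ := exists_isGlued hspec hT hU hne fun m => h𝒞.subset (hκ m)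
  have hrec : IsFullyRecurrent T x := hx.isFullyRecurrent fun y s hs' => by
    obtain ⟨i, hi⟩ := hcr y s hs'
    refine ⟨i + 1, ?_⟩
    have h1 := integ_mono (ρ i) hi
    have h2 := integ_nonneg ν₀ (bump_nonneg y s)
    have h3 := hρpos i
    have h4 : (0 : ℝ) < harmonicWeight (i + 1) := by simp only [harmonicWeight]; positivity
    have h5 : (0 : ℝ) ≤ 1 - harmonicWeight (i + 1) := sub_nonneg.2 (harmonicWeight (i + 1)).2.2
    change 0 < integ (mix (harmonicWeight (i + 1)) ν₀ (ρ i)) (bump y s)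
    rw [integ_mix]
    have h6 := mul_nonneg h5 h2
    have h7 := mul_pos h4 (h3.trans_le h1)
    linarith
  refine ⟨x, hxU, ⟨hrec.mem_quasiWeaklyAlmostPeriodic, ?_⟩, ?_,
    fun φ a h => hx.tendsto fun m => h _ (hκ m)⟩
  · rintro ⟨-, C, hC, μ, hμ, hsupp⟩
    rw [hrec.center_eq_univ hC.prop] at hsupp
    refine (hx.finitelySupported_of_mem_limitMeasures hlim.isCompact_insert_range
      (fun m => Or.inr ⟨m, rfl⟩) ?_ hμ).support_ne_univ hsupp
    rintro _ (rfl | ⟨m, rfl⟩)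
    exacts [hs.fin₀, hs.fin₀.mix (hρ'fin m) _]
  · rintro ⟨L, hL⟩
    have h0 := hx.eq_of_tendsto hL
    have h1 : integ ν₁ ψ = L := by
      rw [← h0 0]
      change _ = integ (mix (harmonicWeight 0) ν₀ ν₁) ψ
      rw [integ_mix, harmonicWeight]
      norm_num
    have h2 : integ ν₀ ψ = L := by
      refine tendsto_nhds_unique (tendsto_iff_integ.1 hlim ψ) ?_
      simp only [h0]
      exact tendsto_const_nhds
    exact hs.integ_ne (h2.trans h1.symm)

/-- Oscillate between two finitely supported measures from a point off both carriers: the orbit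
visits a neighbourhood of the point with frequency zero. -/
theorem IsRich.exists_irregular_diff (hspec : BowenSpecification T)
    (hT : Continuous T) (h𝒞 : IsRich T 𝒞) (hs : Separates T 𝒞 ψ ν₀ ν₁) (hU : IsOpen U)
    (hne : U.Nonempty) : ∃ x ∈ U, x ∈ irregular T \ quasiWeaklyAlmostPeriodic T ∧
      x ∈ phiIrregular T ψ ∧ ∀ φ a, (∀ μ ∈ 𝒞, integ μ φ = a) → x ∈ phiLevel T φ a := by
  have hκ := pairSeq_forall (p := (· ∈ 𝒞)) hs.mem₀ hs.mem₁
  obtain ⟨F, hF, -, -, h₀F⟩ := hs.fin₀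
  obtain ⟨G, hG, -, -, h₁G⟩ := hs.fin₁
  have hFG := hF.union hG
  obtain ⟨x, ⟨hxU, hxF⟩, hx⟩ := exists_isGlued hspec hT (hU.sdiff hFG.isClosed)
    (hspec.diff_finite_nonempty hT hU hne hFG) fun m => h𝒞.subset (hκ m)
  have hirr : x ∈ phiIrregular T ψ := hx.mem_phiIrregular (m := 0) (m' := 1) hs.integ_ne
  refine ⟨x, hxU, ⟨fun h => hirr (quasiregular_subset_phiRegular ψ h), ?_⟩, hirr,
    fun φ a h => hx.tendsto fun m => h _ (hκ m)⟩
  have hnull := pairSeq_forall (p := fun μ => (μ : Measure X) (F ∪ G)ᶜ = 0) (μ := ν₀) (ν := ν₁)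
    (measure_mono_null (Set.compl_subset_compl.2 Set.subset_union_left) h₀F)
    (measure_mono_null (Set.compl_subset_compl.2 Set.subset_union_right) h₁G)
  obtain ⟨r, hr, hrF⟩ := Metric.isOpen_iff.1 hFG.isClosed.isOpen_compl x hxF
  refine notMem_quasiWeaklyAlmostPeriodic hr (hx.tendsto fun m =>
    integ_eq_zero_of_eqOn (hnull m) fun z hz => bump_eq_zero ?_)
  by_contra h
  exact hrF (not_le.1 h) hz

theorem closure_inter_eq_of_dense {S Y : Set X}
    (h : ∀ U : Set X, IsOpen U → U.Nonempty → ∃ x ∈ U, x ∈ S ∧ x ∈ Y) :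
    closure (S ∩ Y) = closure Y := by
  have hd : Dense (S ∩ Y) := dense_iff_inter_open.2 fun U hU hne =>
    let ⟨x, hxU, hx⟩ := h U hU hne
    ⟨x, hxU, hx⟩
  rw [hd.closure_eq, (hd.mono Set.inter_subset_right).closure_eq]

/-- `hY` lists what all these witnesses share: divergence for `ψ`, and convergence for each function
whose integral is constant on `𝒞`. The former serves irregular sets `Y`, the latter level sets. -/
theorem IsRich.hasDenseGaps_of_separates (hspec : BowenSpecification T)
    (hT : Continuous T) (h𝒞 : IsRich T 𝒞) (hs : Separates T 𝒞 ψ ν₀ ν₁) {Y : Set X}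
    (hY : ∀ x ∈ phiIrregular T ψ, (∀ φ a, (∀ μ ∈ 𝒞, integ μ φ = a) → x ∈ phiLevel T φ a) →
      x ∈ Y) :
    HasDenseGaps [quasiregular T, weaklyAlmostPeriodic T, V T, quasiWeaklyAlmostPeriodic T,
      irregular T] Y := by
  simp only [HasDenseGaps, List.isChain_cons_cons, List.isChain_singleton, and_true]
  refine ⟨?_, ?_, ?_, ?_⟩ <;> refine closure_inter_eq_of_dense fun U hU hne => ?_
  · obtain ⟨x, hxU, hx, h1, h2⟩ :=
      h𝒞.exists_weaklyAlmostPeriodic_diff hspec hT hs hU hne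
    exact ⟨x, hxU, hx, hY x h1 h2⟩
  · obtain ⟨x, hxU, hx, h1, h2⟩ := h𝒞.exists_V_diff hspec hT hs hU hne
    exact ⟨x, hxU, hx, hY x h1 h2⟩
  · obtain ⟨x, hxU, hx, h1, h2⟩ :=
      h𝒞.exists_quasiWeaklyAlmostPeriodic_diff hspec hT hs hU hne
    exact ⟨x, hxU, hx, hY x h1 h2⟩
  · obtain ⟨x, hxU, hx, h1, h2⟩ := h𝒞.exists_irregular_diff hspec hT hs hU hne
    exact ⟨x, hxU, hx, hY x h1 h2⟩

theorem IsRich.hasDenseGaps (hspec : BowenSpecification T) (hT : Continuous T)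
    (h𝒞 : IsRich T 𝒞) {Y : Set X}
    (hY : ∀ x, (∀ φ a, (∀ μ ∈ 𝒞, integ μ φ = a) → x ∈ phiLevel T φ a) → x ∈ Y) :
    HasDenseGaps [almostPeriodic T ∪ regular T, quasiregular T, weaklyAlmostPeriodic T, V T,
      quasiWeaklyAlmostPeriodic T, irregular T] Y := by
  obtain ⟨ψ, ν₀, ν₁, hs⟩ := h𝒞.exists_separates
  refine List.isChain_cons_cons.2 ⟨closure_inter_eq_of_dense fun U hU hne => ?_,
    h𝒞.hasDenseGaps_of_separates hspec hT hs fun x _ => hY x⟩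
  obtain ⟨x, hxU, hx, h⟩ := h𝒞.exists_quasiregular_diff hspec hT hU hne
  exact ⟨x, hxU, hx, hY x h⟩

theorem HasDenseGaps.cons_almostPeriodic (hspec : BowenSpecification T) (hT : Continuous T)
    {Y : Set X} {Z : List (Set X)} (hZ : HasDenseGaps ((almostPeriodic T ∪ regular T) :: Z) Y)
    (hY : quasiregular T ⊆ Y) :
    HasDenseGaps (almostPeriodic T :: (almostPeriodic T ∪ regular T) :: Z) Y := by
  refine List.isChain_cons_cons.2 ⟨closure_inter_eq_of_dense fun U hU hne => ?_, hZ⟩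
  obtain ⟨x, hxU, hx⟩ := exists_regular_diff_almostPeriodic hspec hT hU hne
  refine ⟨x, hxU, ⟨Or.inr hx.1, hx.2⟩, hY ?_⟩
  obtain ⟨μ, hμ, hg, -⟩ := Set.mem_iUnion₂.1 hx.1
  exact Set.mem_iUnion₂.2 ⟨μ, (show Ergodic T (μ : Measure X) from hμ).toMeasurePreserving, hg⟩

end Gaps

/-! ### Level slices and the values of periodic measures -/

section Levels

variable {X : Type*} [MetricSpace X] [CompactSpace X] [MeasurableSpace X] [BorelSpace X]
  {T : X → X} {φ : C(X, ℝ)}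

/-- A periodic measure charging the given ball is mixed with `μ₀` or `μ₁` to correct its
`φ`-integral to `a`; since `a` lies strictly between their values, the charging measure keeps
positive weight. -/
theorem isRich_level (hspec : BowenSpecification T) (hT : Continuous T) {a : ℝ}
    {μ₀ μ₁ : ProbabilityMeasure X} (h₀ : μ₀ ∈ periodicMeasures T) (h₁ : μ₁ ∈ periodicMeasures T)
    (ha₀ : integ μ₀ φ < a) (ha₁ : a < integ μ₁ φ) :
    IsRich T {μ ∈ periodicClosure T | integ μ φ = a} where
  isClosed := isClosed_closure.inter (isClosed_eq (continuous_integ φ) continuous_const)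
  subset := fun _ h => h.1
  mix_mem t μ ν hμ hν := by
    refine ⟨mix_mem_periodicClosure hspec hT t hμ.1 hν.1, ?_⟩
    rw [integ_mix, hμ.2, hν.2]
    ring
  exists_charging y r hr := by
    obtain ⟨ρ, hρ, hpos⟩ := exists_periodicMeasure_charging hspec y hr
    have key : ∀ σ ∈ periodicMeasures T, ∀ t : unitInterval, (t : ℝ) < 1 →
        integ (mix t ρ σ) φ = a → ∃ ρ ∈ {μ ∈ periodicClosure T | integ μ φ = a},
          FinitelySupported T ρ ∧ 0 < integ ρ (bump y r) := by
      intro σ hσ t ht hint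
      refine ⟨mix t ρ σ, ⟨mix_mem_periodicClosure hspec hT t (periodicMeasures_subset_closure hρ)
        (periodicMeasures_subset_closure hσ), hint⟩,
        (finitelySupported_of_mem_periodicMeasures hρ).mix
          (finitelySupported_of_mem_periodicMeasures hσ) t, ?_⟩
      rw [integ_mix]
      have h1 := mul_pos (sub_pos.2 ht) hpos
      have h2 := mul_nonneg t.2.1 (integ_nonneg σ (bump_nonneg y r))
      linarith
    rcases le_total (integ ρ φ) a with h | h
    · have hd : 0 < integ μ₁ φ - integ ρ φ := by linarith
      refine key μ₁ h₁ ⟨(a - integ ρ φ) / (integ μ₁ φ - integ ρ φ),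
        div_nonneg (by linarith) hd.le, (div_le_one hd).2 (by linarith)⟩
        ((div_lt_one hd).2 (by linarith)) ?_
      rw [integ_mix]
      field_simp
      ring
    · have hd : 0 < integ ρ φ - integ μ₀ φ := by linarith
      refine key μ₀ h₀ ⟨(integ ρ φ - a) / (integ ρ φ - integ μ₀ φ),
        div_nonneg (by linarith) hd.le, (div_le_one hd).2 (by linarith)⟩
        ((div_lt_one hd).2 (by linarith)) ?_
      rw [integ_mix]
      field_simp
      ring

/-- Divergent averages differ by at least `ε` at arbitrarily late times; approximating both within
`ε / 3` by periodic measures separates the integrals. -/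
theorem exists_periodicMeasures_integ_lt (hspec : BowenSpecification T) (hT : Continuous T)
    (h : (phiIrregular T φ).Nonempty) : ∃ μ₀ ∈ periodicMeasures T, ∃ μ₁ ∈ periodicMeasures T,
      integ μ₀ φ < integ μ₁ φ := by
  obtain ⟨x, hx⟩ := h
  have hcau : ¬ CauchySeq fun n => birkhoffAverage ℝ T φ n x := fun hc =>
    hx (cauchySeq_tendsto_of_complete hc)
  rw [Metric.cauchySeq_iff] at hcau
  push Not at hcau
  obtain ⟨ε, hε, hN⟩ := hcau
  obtain ⟨n₀, hn₀⟩ := exists_periodicMeasure_near_average hspec hT φ (η := ε / 3) (by positivity)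
  obtain ⟨m, hm, n, hn, hmn⟩ := hN n₀
  obtain ⟨μ, hμ, hμ'⟩ := hn₀ m hm x
  obtain ⟨ν, hν, hν'⟩ := hn₀ n hn x
  rw [Real.dist_eq] at hmn
  rcases lt_trichotomy (integ μ φ) (integ ν φ) with hlt | heq | hgt
  · exact ⟨μ, hμ, ν, hν, hlt⟩
  · exfalso
    rw [heq] at hμ'
    have := abs_sub_le (birkhoffAverage ℝ T φ m x) (integ ν φ) (birkhoffAverage ℝ T φ n x)
    rw [abs_sub_comm (integ ν φ)] at this
    linarith
  · exact ⟨ν, hν, μ, hμ, hgt⟩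

/-- An invariant measure with integral below `a` has points whose finite averages are no larger than
that integral, and closing up their orbits keeps the value below `a`; symmetrically above. -/
theorem exists_periodicMeasures_of_mem_interior (hspec : BowenSpecification T)
    (hT : Continuous T) {a : ℝ} (ha : a ∈ interior (spectrumInterval T φ)) :
    ∃ μ₀ ∈ periodicMeasures T, ∃ μ₁ ∈ periodicMeasures T,
      integ μ₀ φ < a ∧ a < integ μ₁ φ := by
  rw [spectrumInterval, interior_Icc] at ha
  -- For an empty set both `sInf` and `sSup` would be `0`, leaving no interior point.
  have hne : (phiIntegrals T φ).Nonempty := by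
    by_contra h
    rw [Set.not_nonempty_iff_eq_empty.1 h] at ha
    simp only [Real.sInf_empty, Real.sSup_empty] at ha
    exact lt_asymm ha.1 ha.2
  obtain ⟨_, ⟨μ, hμ, rfl⟩, hlt⟩ := exists_lt_of_csInf_lt hne ha.1
  obtain ⟨_, ⟨ν, hν, rfl⟩, hgt⟩ := exists_lt_of_lt_csSup hne ha.2
  change integ μ φ < a at hlt
  change a < integ ν φ at hgt
  have hinv : ∀ μ ∈ invariantMeasures T, ∀ n, 0 < n →
      ∫ x, averageMap hT φ n x ∂(μ : Measure X) = integ μ φ := fun μ hμ n hn =>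
    integral_birkhoffAverage hT hμ φ hn
  obtain ⟨n₀, hn₀⟩ := exists_periodicMeasure_near_average hspec hT φ
    (η := (a - integ μ φ) / 2) (by linarith)
  obtain ⟨n₁, hn₁⟩ := exists_periodicMeasure_near_average hspec hT φ
    (η := (integ ν φ - a) / 2) (by linarith)
  obtain ⟨x, hx⟩ := exists_le_integral (integrable_continuousMap (μ : Measure X)
    (averageMap hT φ (n₀ + 1)))
  obtain ⟨y, hy⟩ := exists_integral_le (integrable_continuousMap (ν : Measure X)
    (averageMap hT φ (n₁ + 1)))
  rw [hinv μ hμ _ (Nat.succ_pos _), averageMap_apply] at hx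
  rw [hinv ν hν _ (Nat.succ_pos _), averageMap_apply] at hy
  obtain ⟨μ₀, h₀, h₀'⟩ := hn₀ (n₀ + 1) (Nat.le_succ _) x
  obtain ⟨μ₁, h₁, h₁'⟩ := hn₁ (n₁ + 1) (Nat.le_succ _) y
  have h2 := abs_le.1 h₀'
  have h3 := abs_le.1 h₁'
  exact ⟨μ₀, h₀, μ₁, h₁, by linarith [h2.1], by linarith [h3.2]⟩

end Levels

end BowenSpec

open BowenSpec in
theorem proposition9p1 {X : Type*} [MetricSpace X] [CompactSpace X] [Infinite X]
    [MeasurableSpace X] [BorelSpace X] (T : X → X) (hT : Continuous T)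
    (hspec : BowenSpecification T) :
    HasDenseGaps [almostPeriodic T, almostPeriodic T ∪ regular T, quasiregular T,
      weaklyAlmostPeriodic T, V T, quasiWeaklyAlmostPeriodic T, irregular T] Set.univ ∧
    (∀ φ : C(X, ℝ),
      HasDenseGaps [almostPeriodic T, almostPeriodic T ∪ regular T, quasiregular T,
        weaklyAlmostPeriodic T, V T, quasiWeaklyAlmostPeriodic T, irregular T]
        (phiRegular T φ)) ∧
    (∀ φ : C(X, ℝ), (phiIrregular T φ).Nonempty →
      HasDenseGaps [quasiregular T, weaklyAlmostPeriodic T, V T, quasiWeaklyAlmostPeriodic T,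
        irregular T] (phiIrregular T φ)) ∧
    (∀ φ : C(X, ℝ), (phiIrregular T φ).Nonempty →
      ∀ a ∈ interior (spectrumInterval T φ),
        HasDenseGaps [almostPeriodic T ∪ regular T, quasiregular T, weaklyAlmostPeriodic T, V T,
          quasiWeaklyAlmostPeriodic T, irregular T] (phiLevel T φ a)) := by
  have hrich := isRich_periodicClosure hspec hT
  have huniv := (hrich.hasDenseGaps hspec hT (Y := Set.univ) fun _ _ =>
    trivial).cons_almostPeriodic hspec hT (Set.subset_univ _)
  refine ⟨huniv, fun φ => ?_, fun φ hφ => ?_, fun φ _ a ha => ?_⟩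
  -- Without irregular points `phiRegular T φ` is all of `X`; otherwise a level strictly between two
  -- periodic values supplies the witnesses.
  · rcases (phiIrregular T φ).eq_empty_or_nonempty with h | h
    · rw [phiIrregular, Set.compl_empty_iff] at h
      rw [h]
      exact huniv
    · obtain ⟨μ₀, h₀, μ₁, h₁, hlt⟩ := exists_periodicMeasures_integ_lt hspec hT h
      obtain ⟨a, ha₀, ha₁⟩ := exists_between hlt
      exact ((isRich_level hspec hT h₀ h₁ ha₀ ha₁).hasDenseGaps hspec hT
        (Y := phiRegular T φ) fun x hx => ⟨a, hx φ a fun _ h => h.2⟩).cons_almostPeriodic hspec hT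
        (quasiregular_subset_phiRegular φ)
  · obtain ⟨μ₀, h₀, μ₁, h₁, hlt⟩ := exists_periodicMeasures_integ_lt hspec hT hφ
    exact hrich.hasDenseGaps_of_separates hspec hT
      ⟨periodicMeasures_subset_closure h₀, periodicMeasures_subset_closure h₁,
        finitelySupported_of_mem_periodicMeasures h₀,
        finitelySupported_of_mem_periodicMeasures h₁, hlt.ne⟩ fun x hx _ => hx
  · obtain ⟨μ₀, h₀, μ₁, h₁, ha₀, ha₁⟩ := exists_periodicMeasures_of_mem_interior hspec hT ha
    exact (isRich_level hspec hT h₀ h₁ ha₀ ha₁).hasDenseGaps hspec hT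
      fun x hx => hx φ a fun _ h => h.2
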